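/- **Conventions.** Unprimed spinor indices $A,B,\dots\in\{0,1\}$ are raised and lowered with $\epsilon^{01}=\epsilon_{01}=1$, $\xi^A=\epsilon^{AB}\xi_B$, $\xi_B=\xi^A\epsilon_{AB}$. Let $M=S^3\times(0,1)$, $\bar M=S^3\times[0,1]$, $\mathscr I^-=S^3\times\{0\}$, $\mathscr I^+=S^3\times\{1\}$, $C_t=S^3\times\{t\}$, oriented so that $\partial \bar M=\mathscr I^+-\mathscr I^-$. All forms are smooth and complex-valued. Let $\Lambda,\kappa,\varepsilon$ be nonzero real numbers. **Background.** Let $(\Sigma_0^{AB},\Gamma_{0\,AB})$, symmetric in $AB$, be a self-dual solution of the Plebanski equations on $M$: with $\mathrm D_0$ the covariant derivative of $\Gamma_0$ ($\mathrm D_0X^{AB}=\mathrm dX^{AB}+2\Gamma^{(A}_{0\,C}\wedge X^{B)C}$) and $F_0$ its curvature, $$\mathrm D_0\Sigma_0^{AB}=0,\qquad F_{0\,AB}=\tfrac{\Lambda}{3}\Sigma_{0\,AB},\qquad \Sigma_0^{(AB}\wedge\Sigma_0^{CD)}=0,$$ with nowhere vanishing volume form $\mathrm d\mu$ normalised by $\Sigma_0^{AB}\wedge\Sigma_{0\,AB}=6\,\mathrm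 d\mu$. Assume that it has a smooth conformal compactification: there is a real $\Omega\in C^\infty(\bar M)$ with $\Omega\ne0$ on $M$, $\Omega=0$ and $\mathrm d\Omega\neq0$ on $\partial\bar M$, such that $\Omega^2\Sigma_0^{AB}$ extends to $\bar M$, smooth and nondegenerate. **States.** For $i=1,2$ let $h_i=(\sigma_i^{AB},\gamma_{i\,AB})$, symmetric in $AB$, with a totally symmetric spinor field $\psi_{i\,ABCD}$ (the linearized Weyl spinor), solve the linearized Einstein equations $$\mathrm D_0\sigma_i^{AB}=-2\gamma^{(A}_{i\,C}\wedge\Sigma_0^{B)C},\qquad \mathrm D_0\gamma_{i\,AB}=\psi_{i\,ABCD}\Sigma_0^{CD}+\tfrac{\Lambda}{3}\sigma_{i\,AB},\qquad \sigma_i^{(AB}\wedge\Sigma_0^{CD)}=0$$ on $M$, and assume that $\Omega^2\sigma_i$ and $\Omega^{-2}\psi_i$ extend smoothly to $\bar M$. Call $h$ anti-self-dual at $\mathscr I^{\pm}$ if $\sigma$ extends smoothly to $M\cup\mathscr I^\pm$ and $\int_{C_t}\sigma^{AB}\wedge\gamma_{AB}\to0$, as $C_t\to\mathscr I^\pm$,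 for all symmetric families $\gamma_{AB}$ of $1$-forms smooth on $\bar M$. Assume that $h_1$ is anti-self-dual at $\mathscr I^-$ and $h_2$ is anti-self-dual at $\mathscr I^+$. **Generating functionals.** The Einstein one is $I^{\mathrm{GR}}[1^-,2^-,M^+]=\langle h_2|h_1\rangle$, where $$\langle h_i|h_j\rangle=-\frac{i}{\kappa^2}\int_{C_t}\bigl(\sigma_j^{AB}\wedge\gamma_{i\,AB}-\sigma_i^{AB}\wedge\gamma_{j\,AB}\bigr)$$ is the inner product induced by the symplectic form $\kappa^{-2}\int_C\delta\Sigma^{AB}\wedge\delta\Gamma_{AB}$. The conformal gravity one is $$I^{\mathrm{CG}}[1^-,2^-,M^+]=\frac{2i}{\varepsilon^2}\int_M\mathrm d\mu\;\psi_1^{ABCD}\psi_{2\,ABCD}.$$ **Proposition.** The integral defining $I^{\mathrm{CG}}$ converges absolutely and, for every slice $C_t$, $0<t<1$ (so that $I^{\mathrm{GR}}$ does not depend on the slice, and its limit at $\mathscr I^+$ has the same value), $$I^{\mathrm{GR}}[1^-,2^-,M^+]=-\frac{3\varepsilon^2}{\Lambda\kappa^2}\,I^{\mathrm{CG}}[1^-,2^-,M^+].$$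 -/

import Mathlib

open MeasureTheory Set Filter Topology
open scoped ContDiff

noncomputable section

namespace MHV

/-! ### Differential forms on open subsets of `ℝ⁴` -/

/-- `ℝ⁴` with its Euclidean structure; it only serves to carry the manifold `S³ × (0,1)`. -/
abbrev E4 : Type := EuclideanSpace ℝ (Fin 4)

/-- Complex-valued exterior `p`-covectors on `ℝ⁴`. -/
abbrev Cov (p : ℕ) : Type := E4 [⋀^Fin p]→L[ℝ] ℂ

/-- Complex-valued differential `p`-forms. -/
abbrev Form (p : ℕ) : Type := E4 → Cov p

/-- The multilinear map `(v₁, …, v_{p+q}) ↦ α (v₁, …, v_p) * β (v_{p+1}, …, v_{p+q})`. -/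
def tensorCov {p q n : ℕ} (h : p + q = n) (α : Cov p) (β : Cov q) :
    ContinuousMultilinearMap ℝ (fun _ : Fin n => E4) ℂ where
  toMultilinearMap :=
    ((LinearMap.mul' ℝ ℂ).compMultilinearMap
      (MultilinearMap.domCoprod α.toMultilinearMap β.toMultilinearMap)).domDomCongr
        (finSumFinEquiv.trans (finCongr h))
  cont := by
    subst h
    change Continuous fun v : Fin (p + q) → E4 =>
      α (fun i => v (Fin.castAdd q i)) * β (fun j => v (Fin.natAdd p j))
    fun_prop

/-- The wedge product of exterior covectors,
`(α ∧ β)(v) = 1 / (p! q!) ∑_π sign π · α (v_{π 1}, …, v_{π p}) · β (v_{π (p+1)}, …, v_{π (p+q)})`. -/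
def wedgeCov {p q n : ℕ} (h : p + q = n) (α : Cov p) (β : Cov q) : Cov n :=
  (1 / ((p.factorial : ℝ) * (q.factorial : ℝ))) •
    ContinuousMultilinearMap.alternatization (tensorCov h α β)

theorem wedgeCov_apply {p q : ℕ} (α : Cov p) (β : Cov q) (v : Fin (p + q) → E4) :
    wedgeCov rfl α β v = (1 / ((p.factorial : ℝ) * (q.factorial : ℝ))) •
      ∑ π : Equiv.Perm (Fin (p + q)), Equiv.Perm.sign π •
        (α (fun i => v (π (Fin.castAdd q i))) * β (fun j => v (π (Fin.natAdd p j)))) := by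
  simp only [wedgeCov, ContinuousAlternatingMap.smul_apply,
    ContinuousMultilinearMap.alternatization_apply_apply]
  rfl

/-- The wedge product of differential forms. -/
def wedge {p q n : ℕ} (h : p + q = n) (α : Form p) (β : Form q) : Form n :=
  fun x => wedgeCov h (α x) (β x)

/-! ### The manifold `M ≃ S³ × (0,1)` and integration on it

`M` is realised as the open shell `1 < ‖x‖ < 2` in `ℝ⁴`, through `x ↦ (x / ‖x‖, ‖x‖ - 1)`.
Its compactification is the closed shell; past infinity is the sphere of radius `1`, future
infinity the sphere of radius `2`, and the Cauchy slices are the spheres of radius `r`,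
`1 < r < 2`. -/

/-- The space-time manifold. -/
def M : Set E4 := {x | 1 < ‖x‖ ∧ ‖x‖ < 2}

/-- The compactified space-time `S³ × [0,1]`. -/
def Mbar : Set E4 := {x | 1 ≤ ‖x‖ ∧ ‖x‖ ≤ 2}

/-- The component of the conformal boundary at radius `ρ` (`ρ = 1` past, `ρ = 2` future). -/
def scri (ρ : ℝ) : Set E4 := Metric.sphere 0 ρ

/-- Standard basis of `ℝ⁴`. -/
def stdB (i : Fin 4) : E4 := EuclideanSpace.single i (1 : ℝ)

/-- The coefficient of a `4`-covector with respect to `dx⁰ ∧ dx¹ ∧ dx² ∧ dx³`. -/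
def topCoeff (μ : Cov 4) : ℂ := μ stdB

/-- The integral of a `3`-form over the sphere of radius `r`, oriented as the boundary of the ball
(outward normal first): in terms of the unit normal `u`, the restriction of `β` to the sphere is
`∑ⱼ (-1)ʲ uⱼ β(e₀, …, êⱼ, …, e₃)` times the Euclidean area element. -/
def sliceIntegral (r : ℝ) (β : Form 3) : ℂ :=
  ∫ u : Metric.sphere (0 : E4) 1,
    ((r ^ 3 : ℝ) : ℂ) * ∑ j : Fin 4, (-1) ^ (j : ℕ) * (((u : E4) j : ℝ) : ℂ) *
      β (r • (u : E4)) (fun k => stdB (j.succAbove k))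
    ∂((volume : Measure E4).toSphere)

/-- `f` is, on `s`, the restriction of a map that is smooth on the larger set `t`. -/
def ExtendsSmoothly {V : Type*} [NormedAddCommGroup V] [NormedSpace ℝ V]
    (f : E4 → V) (s t : Set E4) : Prop :=
  ∃ g : E4 → V, ContDiffOn ℝ ∞ g t ∧ EqOn g f s

/-! ### Two-component spinor indices

Conventions: `ε^{01} = ε_{01} = 1`, `ξ^A = ε^{AB} ξ_B`, `ξ_B = ξ^A ε_{AB}`. -/

/-- The spinor symbol, `ε^{AB}` as well as `ε_{AB}`. -/
def eps (A B : Fin 2) : ℂ := !![(0 : ℂ), 1; -1, 0] A B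

/-- A pair of (upper or lower) spinor indices carrying a `p`-form. -/
abbrev SForm (p : ℕ) : Type := Fin 2 → Fin 2 → Form p

/-- `X_{AB} = X^{CD} ε_{CA} ε_{DB}`. -/
def lower {p : ℕ} (X : SForm p) : SForm p :=
  fun A B x => ∑ C, ∑ D, (eps C A * eps D B) • X C D x

/-- `X^A_B = ε^{AC} X_{CB}`. -/
def raiseFirst {p : ℕ} (X : SForm p) : SForm p :=
  fun A B x => ∑ C, eps A C • X C B x

/-- `X^{AB} ∧ Y_{AB}`. -/
def contract {p q n : ℕ} (h : p + q = n) (X : SForm p) (Y : SForm q) : Form n :=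
  fun x => ∑ A, ∑ B, wedge h (X A B) (Y A B) x

/-- `2 γ^{(A}_C ∧ X^{B)C} = γ^A_C ∧ X^{BC} + γ^B_C ∧ X^{AC}` for a connection-type field `γ_{AB}` and
a field `X^{AB}` with upper indices. -/
def actUpper {p : ℕ} (γ : SForm 1) (X : SForm p) : SForm (p + 1) :=
  fun A B x => ∑ C, (wedge (Nat.add_comm 1 p) (raiseFirst γ A C) (X B C) x +
    wedge (Nat.add_comm 1 p) (raiseFirst γ B C) (X A C) x)

/-- `2 Γ_{C(A} ∧ X^C_{B)} = Γ_{CA} ∧ X^C_B + Γ_{CB} ∧ X^C_A` for a field `X_{AB}` with lower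
indices. -/
def actLower {p : ℕ} (Γ : SForm 1) (X : SForm p) : SForm (p + 1) :=
  fun A B x => ∑ C, (wedge (Nat.add_comm 1 p) (Γ C A) (raiseFirst X C B) x +
    wedge (Nat.add_comm 1 p) (Γ C B) (raiseFirst X C A) x)

/-- `D X^{AB} = d X^{AB} + 2 Γ^{(A}_C ∧ X^{B)C}`. -/
def covDUpper {p : ℕ} (Γ : SForm 1) (X : SForm p) : SForm (p + 1) :=
  fun A B x => extDeriv (X A B) x + actUpper Γ X A B x

/-- `D X_{AB} = d X_{AB} + 2 Γ_{C(A} ∧ X^C_{B)}`. -/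
def covDLower {p : ℕ} (Γ : SForm 1) (X : SForm p) : SForm (p + 1) :=
  fun A B x => extDeriv (X A B) x + actLower Γ X A B x

/-- The curvature `F_{AB} = d Γ_{AB} + Γ_{CA} ∧ Γ^C_B` of the connection `D`. -/
def curvature (Γ : SForm 1) : SForm 2 :=
  fun A B x => extDeriv (Γ A B) x + ∑ C, wedge rfl (Γ C A) (raiseFirst Γ C B) x

/-- The total symmetrisation (up to the factor `1/4!`) of `X^{AB} ∧ Y^{CD}`. -/
def symWedge (X Y : SForm 2) (I : Fin 4 → Fin 2) : Form 4 :=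
  fun x => ∑ π : Equiv.Perm (Fin 4),
    wedge rfl (X (I (π 0)) (I (π 1))) (Y (I (π 2)) (I (π 3))) x

/-- The volume form of the chiral formulation: `Σ^{AB} ∧ Σ_{AB} = 6 dμ`, which for a `Σ` with
`Σ^{(AB} ∧ Σ^{CD)} = 0` says `Σ^{AB} ∧ Σ^{CD} = (ε^{AC} ε^{BD} + ε^{AD} ε^{BC}) dμ`. -/
def volForm (S : SForm 2) : Form 4 :=
  fun x => (1 / 6 : ℂ) • contract (n := 4) rfl S (lower S) x

/-- Fields `ψ_{ABCD}` with four lower spinor indices. -/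
abbrev Spinor4 : Type := E4 → (Fin 4 → Fin 2) → ℂ

/-- `ψ_{ABCD} Σ^{CD}`. -/
def weylForm (ψ : Spinor4) (S : SForm 2) : SForm 2 :=
  fun A B x => ∑ C, ∑ D, ψ x ![A, B, C, D] • S C D x

/-- `φ^{ABCD} χ_{ABCD}`, at a point. -/
def contract4 (φ χ : (Fin 4 → Fin 2) → ℂ) : ℂ :=
  ∑ I : Fin 4 → Fin 2, ∑ J : Fin 4 → Fin 2, (∏ k, eps (I k) (J k)) * φ J * χ I

/-! ### Self-dual backgrounds -/

/-- A (complex) self-dual solution `(Σ₀^{AB}, Γ₀_{AB})` of the Plebanski equations on `M` with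
cosmological constant `Λ`: the field equations with vanishing anti-self-dual Weyl spinor. -/
structure IsSelfDualBackground (Λ : ℝ) (S : SForm 2) (Γ : SForm 1) : Prop where
  symm_S : ∀ A B, S A B = S B A
  symm_Γ : ∀ A B, Γ A B = Γ B A
  smooth_S : ∀ A B, ContDiffOn ℝ ∞ (S A B) M
  smooth_Γ : ∀ A B, ContDiffOn ℝ ∞ (Γ A B) M
  /-- `D Σ^{AB} = 0`. -/
  torsion_free : ∀ A B, ∀ x ∈ M, covDUpper Γ S A B x = 0
  /-- `F_{AB} = (Λ/3) Σ_{AB}`. -/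
  curvature_eq : ∀ A B, ∀ x ∈ M, curvature Γ A B x = ((Λ / 3 : ℝ) : ℂ) • lower S A B x
  /-- `Σ^{(AB} ∧ Σ^{CD)} = 0`. -/
  simplicity : ∀ I, ∀ x ∈ M, symWedge S S I x = 0
  nondegenerate : ∀ x ∈ M, volForm S x ≠ 0

/-- Smooth conformal compactification with conformal factor `Ω`: the rescaled metric `Ω² g`, that is
`Ω² Σ₀`, is smooth and nondegenerate up to the boundary, and `Ω` is a defining function of the
boundary. -/
structure IsConformalCompactification (Ω : E4 → ℝ) (S : SForm 2) : Prop where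
  smooth : ContDiffOn ℝ ∞ Ω Mbar
  ne_zero : ∀ x ∈ M, Ω x ≠ 0
  eq_zero : ∀ x ∈ scri 1 ∪ scri 2, Ω x = 0
  deriv_ne_zero : ∀ x ∈ scri 1 ∪ scri 2, fderivWithin ℝ Ω Mbar x ≠ 0
  rescaled : ∃ S' : SForm 2, (∀ A B, ContDiffOn ℝ ∞ (S' A B) Mbar) ∧
    (∀ A B, ∀ x ∈ M, S' A B x = (Ω x ^ 2) • S A B x) ∧ ∀ x ∈ Mbar, volForm S' x ≠ 0

/-! ### Linearised Einstein states on the background -/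

/-- A perturbation `h = (σ^{AB}, γ_{AB})` with its linearised Weyl spinor `ψ_{ABCD}`. -/
structure Perturbation where
  σ : SForm 2
  γ : SForm 1
  ψ : Spinor4

/-- `h` is an Einstein scattering state: a smooth solution of the linearised Plebanski equations whose
perturbation `Ω² σ` of the rescaled `Ω² Σ₀` and whose linearised Weyl spinor `Ω⁻² ψ` relative to
`Ω² Σ₀` (so that `ψ_{ABCD} Σ^{CD}` is unchanged) are smooth up to the conformal boundary. -/
structure IsScatteringState (Λ : ℝ) (S : SForm 2) (Γ : SForm 1) (Ω : E4 → ℝ)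
    (h : Perturbation) : Prop where
  symm_σ : ∀ A B, h.σ A B = h.σ B A
  symm_γ : ∀ A B, h.γ A B = h.γ B A
  symm_ψ : ∀ x, ∀ (π : Equiv.Perm (Fin 4)) (I : Fin 4 → Fin 2), h.ψ x (I ∘ π) = h.ψ x I
  smooth_σ : ∀ A B, ContDiffOn ℝ ∞ (h.σ A B) M
  smooth_γ : ∀ A B, ContDiffOn ℝ ∞ (h.γ A B) M
  smooth_ψ : ContDiffOn ℝ ∞ h.ψ M
  /-- `D₀ σ^{AB} = - 2 γ^{(A}_C ∧ Σ₀^{B)C}`. -/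
  lin_torsion : ∀ A B, ∀ x ∈ M, covDUpper Γ h.σ A B x = - actUpper h.γ S A B x
  /-- `D₀ γ_{AB} = ψ_{ABCD} Σ₀^{CD} + (Λ/3) σ_{AB}`. -/
  lin_curvature : ∀ A B, ∀ x ∈ M,
    covDLower Γ h.γ A B x = weylForm h.ψ S A B x + ((Λ / 3 : ℝ) : ℂ) • lower h.σ A B x
  /-- `σ^{(AB} ∧ Σ₀^{CD)} = 0`. -/
  lin_simplicity : ∀ I, ∀ x ∈ M, symWedge h.σ S I x = 0
  regular_σ : ∀ A B, ExtendsSmoothly (fun x => (Ω x ^ 2) • h.σ A B x) M Mbar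
  regular_ψ : ExtendsSmoothly (fun x => (Ω x ^ 2)⁻¹ • h.ψ x) M Mbar

/-- `h` is anti-self-dual at the component `scri ρ` of the conformal boundary: `σ` has a smooth
boundary value there, and `∫_{C_r} σ^{AB} ∧ γ_{AB} → 0` as the slices `C_r` approach `scri ρ`, for
all `γ_{AB}` smooth up to the boundary. -/
def IsASDAt (ρ : ℝ) (h : Perturbation) : Prop :=
  (∀ A B, ExtendsSmoothly (h.σ A B) M (M ∪ scri ρ)) ∧
  ∀ γ : SForm 1, (∀ A B, γ A B = γ B A) → (∀ A B, ContDiffOn ℝ ∞ (γ A B) Mbar) →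
    Tendsto (fun r : ℝ => sliceIntegral r (contract (n := 3) rfl h.σ γ)) (𝓝[Ioo 1 2] ρ) (𝓝 0)

/-! ### The generating functionals -/

/-- The inner product `⟨h_i | h_j⟩ = -(i/κ²) ∫_C (σ_j^{AB} ∧ γ_{i AB} - σ_i^{AB} ∧ γ_{j AB})` on the
slice `C` of radius `r`, induced by the symplectic form `κ⁻² ∫_C δΣ^{AB} ∧ δΓ_{AB}`. -/
def innerProduct (κ r : ℝ) (hi hj : Perturbation) : ℂ :=
  -(Complex.I / (κ : ℂ) ^ 2) *
    sliceIntegral r (fun x => contract (n := 3) rfl hj.σ hi.γ x - contract (n := 3) rfl hi.σ hj.γ x)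

/-- The Einstein generating functional `I^GR[1⁻, 2⁻, M⁺] = ⟨h₂ | h₁⟩`, evaluated on the slice of
radius `r`. -/
def IGR (κ r : ℝ) (h₁ h₂ : Perturbation) : ℂ := innerProduct κ r h₂ h₁

/-- The integrand of `∫_M dμ ψ₁^{ABCD} ψ₂_{ABCD}`. -/
def cgDensity (S : SForm 2) (h₁ h₂ : Perturbation) (x : E4) : ℂ :=
  contract4 (h₁.ψ x) (h₂.ψ x) * topCoeff (volForm S x)

/-- The conformal gravity generating functional
`I^CG[1⁻, 2⁻, M⁺] = (2i/ε²) ∫_M dμ ψ₁^{ABCD} ψ₂_{ABCD}`. -/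
def ICG (ε : ℝ) (S : SForm 2) (h₁ h₂ : Perturbation) : ℂ :=
  (2 * Complex.I / (ε : ℂ) ^ 2) * ∫ x in M, cgDensity S h₁ h₂ x

end MHV

end

noncomputable section

namespace MHV

/-! ### Wedge products of covectors evaluated on vectors -/

/-! Write Ψ_{AB} = ψ_{ABCD} Σ₀^{CD} and, for two states h and h', let J(h,h') = γ_{AB} ∧ Ψ'^{AB}.
Two local identities carry the argument.

(1) dJ(h,h') = 2 ψ^{ABCD} ψ'_{ABCD} dμ (`topCoeff_extDeriv_current`). Indeed D₀Ψ' = 0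
(`extDeriv_weylForm`), so dJ = D₀γ ∧ Ψ' = Ψ ∧ Ψ' + (Λ/3) σ ∧ Ψ'. The last term vanishes by
linearised simplicity and the symmetry of ψ', and simplicity of Σ₀ evaluates Ψ ∧ Ψ'.

(2) J(h',h) - J(h,h') = d(γ ∧ γ') - (Λ/3)(σ ∧ γ' - σ' ∧ γ) (`current_sub_current`), on solving the
linearised curvature equation for Ψ. On a closed slice the exact term integrates to zero
(`sliceIntegral_extDeriv_eq_zero`), so the symplectic product is -(3/Λ) times the difference of the
two fluxes.

The fluxes are fixed by their boundary values. The form Ψ is bounded, because the weights of Ω⁻²ψ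
and Ω²Σ₀ cancel. If σ is regular at a boundary component, then γ = O(Ω) there
(`exists_norm_gamma_le`): the torsion map γ ↦ γ^{(A}_C ∧ Σ^{B)C} is injective for simple
nondegenerate Σ (`torsion_injective`), hence uniformly injective for Ω²Σ₀ on the compact shell.
Background torsion-freeness then gives Γ₀ = O(1/Ω), and the linearised torsion equation, multiplied
by Ω², gives the decay of γ. So J(h₁,h₂) has no flux through past infinity and J(h₂,h₁) none through
future infinity.

With Stokes' theorem on the shell (`sliceIntegral_sub_eq`), J(h₁,h₂) has flux 2∫ over the part of M
before the slice and J(h₂,h₁) has flux -2∫ over the part after it. The two parts add up to all of M,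
giving 6/Λ times the conformal gravity integral (`sliceIntegral_symplectic`), independently of the
slice. -/

theorem sum_perm_fin_three {V : Type*} [AddCommMonoid V] (f : ℤˣ → Fin 3 → Fin 3 → Fin 3 → V) :
    ∑ π : Equiv.Perm (Fin 3), f (Equiv.Perm.sign π) (π 0) (π 1) (π 2) =
      f 1 0 1 2 + f (-1) 0 2 1 + f (-1) 1 0 2 + f 1 1 2 0 + f 1 2 0 1 + f (-1) 2 1 0 := by
  have h2 (p : Fin 3) (e : Equiv.Perm (Fin 2)) :
      Equiv.Perm.decomposeFin.symm (p, e) 2 = Equiv.swap 0 p (e 1).succ :=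
    Equiv.Perm.decomposeFin_symm_apply_succ e p 1
  simp [Finset.univ_perm_fin_succ, Finset.sum_map, ← Finset.univ_product_univ, Finset.sum_product,
    Fin.sum_univ_succ, h2]
  simp [Equiv.swap_apply_def]
  abel

/-- A permutation of four letters is the image p of 0 together with a permutation of the remaining
three, which reduces to the previous sum. Passing the sign as an argument to `f` lets one expansion
serve both wedge products and total symmetrisations. -/
theorem sum_perm_fin_four {V : Type*} [AddCommMonoid V]
    (f : ℤˣ → Fin 4 → Fin 4 → Fin 4 → Fin 4 → V) :
    ∑ π : Equiv.Perm (Fin 4), f (Equiv.Perm.sign π) (π 0) (π 1) (π 2) (π 3) =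
      (f 1 0 1 2 3 + f (-1) 0 1 3 2 + f (-1) 0 2 1 3 + f 1 0 2 3 1 + f 1 0 3 1 2 +
        f (-1) 0 3 2 1) +
      (f (-1) 1 0 2 3 + f 1 1 0 3 2 + f 1 1 2 0 3 + f (-1) 1 2 3 0 + f (-1) 1 3 0 2 +
        f 1 1 3 2 0) +
      (f 1 2 0 1 3 + f (-1) 2 0 3 1 + f (-1) 2 1 0 3 + f 1 2 1 3 0 + f 1 2 3 0 1 +
        f (-1) 2 3 1 0) +
      (f (-1) 3 0 1 2 + f 1 3 0 2 1 + f 1 3 1 0 2 + f (-1) 3 1 2 0 + f (-1) 3 2 0 1 +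
        f 1 3 2 1 0) := by
  have h2 (p : Fin 4) (e : Equiv.Perm (Fin 3)) :
      Equiv.Perm.decomposeFin.symm (p, e) 2 = Equiv.swap 0 p (e 1).succ :=
    Equiv.Perm.decomposeFin_symm_apply_succ e p 1
  have h3 (p : Fin 4) (e : Equiv.Perm (Fin 3)) :
      Equiv.Perm.decomposeFin.symm (p, e) 3 = Equiv.swap 0 p (e 2).succ :=
    Equiv.Perm.decomposeFin_symm_apply_succ e p 2
  rw [Finset.univ_perm_fin_succ, Finset.sum_map, ← Finset.univ_product_univ, Finset.sum_product]
  simp only [Equiv.coe_toEmbedding, Equiv.Perm.decomposeFin.symm_sign, h2, h3,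
    Equiv.Perm.decomposeFin_symm_apply_zero, Equiv.Perm.decomposeFin_symm_apply_one]
  have key (p : Fin 4) := sum_perm_fin_three
    (fun s i j k => f ((if p = 0 then 1 else -1) * s) p (Equiv.swap 0 p i.succ)
      (Equiv.swap 0 p j.succ) (Equiv.swap 0 p k.succ))
  simp only [key, Fin.sum_univ_four]
  simp [Equiv.swap_apply_def, Fin.ext_iff]
  abel

theorem cov_two_swap (B : Cov 2) (u v : E4) : B ![v, u] = -B ![u, v] := by
  have h := B.map_swap ![u, v] (show (0 : Fin 2) ≠ 1 by decide)
  refine Eq.trans ?_ h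
  refine congrArg B ?_
  ext i : 1
  fin_cases i <;> rfl

theorem fin_one_eta (f : Fin 1 → E4) : f = ![f 0] := by
  ext i : 1
  fin_cases i
  rfl

theorem fin_two_eta (f : Fin 2 → E4) : f = ![f 0, f 1] := by
  ext i : 1
  fin_cases i <;> rfl

/-- This and the next three are the shuffle formulas. They turn identities between forms into
polynomial identities in components, so that `ring` can decide them. -/
theorem wedgeCov_one_one (h : 1 + 1 = 2) (α β : Cov 1) (u v : E4) :
    wedgeCov h α β ![u, v] = α ![u] * β ![v] - α ![v] * β ![u] := by
  have e1 (π : Equiv.Perm (Fin 2)) :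
      α (fun i => ![u, v] (π (Fin.castAdd 1 i))) * β (fun j => ![u, v] (π (Fin.natAdd 1 j))) =
        α ![![u, v] (π 0)] * β ![![u, v] (π 1)] :=
    congrArg₂ _ (congrArg α (fin_one_eta _)) (congrArg β (fin_one_eta _))
  refine (wedgeCov_apply α β ![u, v]).trans ?_
  simp only [e1]
  simp [Finset.univ_perm_fin_succ, Finset.sum_map, ← Finset.univ_product_univ,
    Fin.sum_univ_succ, sub_eq_add_neg]

theorem wedgeCov_one_two (h : 1 + 2 = 3) (α : Cov 1) (B : Cov 2) (u v w : E4) :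
    wedgeCov h α B ![u, v, w] =
      α ![u] * B ![v, w] - α ![v] * B ![u, w] + α ![w] * B ![u, v] := by
  have e1 (π : Equiv.Perm (Fin 3)) :
      α (fun i => ![u, v, w] (π (Fin.castAdd 2 i))) * B (fun j => ![u, v, w] (π (Fin.natAdd 1 j))) =
        α ![![u, v, w] (π 0)] * B ![![u, v, w] (π 1), ![u, v, w] (π 2)] :=
    congrArg₂ _ (congrArg α (fin_one_eta _)) (congrArg B (fin_two_eta _))
  refine (wedgeCov_apply α B ![u, v, w]).trans ?_
  have key := sum_perm_fin_three (fun s i j k =>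
    s • (α ![![u, v, w] i] * B ![![u, v, w] j, ![u, v, w] k]))
  simp only [e1]
  refine (congrArg _ key).trans ?_
  simp [cov_two_swap B v w, cov_two_swap B u w, cov_two_swap B u v, Nat.factorial]
  ring

theorem wedgeCov_two_one (h : 2 + 1 = 3) (B : Cov 2) (α : Cov 1) (u v w : E4) :
    wedgeCov h B α ![u, v, w] =
      α ![u] * B ![v, w] - α ![v] * B ![u, w] + α ![w] * B ![u, v] := by
  have e1 (π : Equiv.Perm (Fin 3)) :
      B (fun i => ![u, v, w] (π (Fin.castAdd 1 i))) * α (fun j => ![u, v, w] (π (Fin.natAdd 2 j))) =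
        B ![![u, v, w] (π 0), ![u, v, w] (π 1)] * α ![![u, v, w] (π 2)] :=
    congrArg₂ _ (congrArg B (fin_two_eta _)) (congrArg α (fin_one_eta _))
  refine (wedgeCov_apply B α ![u, v, w]).trans ?_
  have key := sum_perm_fin_three (fun s i j k =>
    s • (B ![![u, v, w] i, ![u, v, w] j] * α ![![u, v, w] k]))
  simp only [e1]
  refine (congrArg _ key).trans ?_
  simp [cov_two_swap B v w, cov_two_swap B u w, cov_two_swap B u v, Nat.factorial]
  ring

theorem wedgeCov_two_two (h : 2 + 2 = 4) (A B : Cov 2) (u v w z : E4) :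
    wedgeCov h A B ![u, v, w, z] =
      A ![u, v] * B ![w, z] - A ![u, w] * B ![v, z] + A ![u, z] * B ![v, w] +
      A ![v, w] * B ![u, z] - A ![v, z] * B ![u, w] + A ![w, z] * B ![u, v] := by
  have e1 (π : Equiv.Perm (Fin 4)) :
      A (fun i => ![u, v, w, z] (π (Fin.castAdd 2 i))) * B (fun j => ![u, v, w, z] (π (Fin.natAdd 2 j))) =
        A ![![u, v, w, z] (π 0), ![u, v, w, z] (π 1)] * B ![![u, v, w, z] (π 2), ![u, v, w, z] (π 3)] :=
    congrArg₂ _ (congrArg A (fin_two_eta _)) (congrArg B (fin_two_eta _))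
  refine (wedgeCov_apply A B ![u, v, w, z]).trans ?_
  have key := sum_perm_fin_four (fun s i j k l =>
    s • (A ![![u, v, w, z] i, ![u, v, w, z] j] * B ![![u, v, w, z] k, ![u, v, w, z] l]))
  simp only [e1]
  refine (congrArg _ key).trans ?_
  simp [cov_two_swap A v w, cov_two_swap A u w, cov_two_swap A u v, cov_two_swap A u z,
    cov_two_swap A v z, cov_two_swap A w z, cov_two_swap B v w, cov_two_swap B u w,
    cov_two_swap B u v, cov_two_swap B u z, cov_two_swap B v z, cov_two_swap B w z, Nat.factorial]
  ring

/-- Finite dimension makes the bilinear wedge automatically continuous and the unit sphere of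
covectors compact; the uniform estimates rely on the latter. -/
instance (p : ℕ) : FiniteDimensional ℝ (Cov p) := by
  let f : Cov p →ₗ[ℝ] MultilinearMap ℝ (fun _ : Fin p => E4) ℂ :=
    { toFun := fun α => α.toMultilinearMap
      map_add' := fun _ _ => rfl
      map_smul' := fun _ _ => rfl }
  refine FiniteDimensional.of_injective f fun α β h => ?_
  ext v
  exact congrArg (fun g : MultilinearMap ℝ (fun _ : Fin p => E4) ℂ => g v) h

/-- The wedge product as a continuous bilinear map. -/
def wedgeL {p q n : ℕ} (h : p + q = n) : Cov p →L[ℝ] Cov q →L[ℝ] Cov n :=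
  (LinearMap.mk₂ ℝ (wedgeCov h)
    (fun α α' β => by
      subst h; ext v
      simp [wedgeCov_apply, add_mul, Finset.sum_add_distrib, smul_add])
    (fun c α β => by
      subst h; ext v
      simp only [wedgeCov_apply, ContinuousAlternatingMap.smul_apply, smul_mul_assoc,
        smul_comm _ c, ← Finset.smul_sum])
    (fun α β β' => by
      subst h; ext v
      simp [wedgeCov_apply, mul_add, Finset.sum_add_distrib, smul_add])
    (fun c α β => by
      subst h; ext v
      simp only [wedgeCov_apply, ContinuousAlternatingMap.smul_apply, mul_smul_comm,
        smul_comm _ c, ← Finset.smul_sum])).toContinuousBilinearMap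

/-! ### The exterior derivative of a wedge product -/

theorem alternatizeUncurryFin_one (f : E4 →L[ℝ] Cov 1) (u v : E4) :
    ContinuousAlternatingMap.alternatizeUncurryFin f ![u, v] = f u ![v] - f v ![u] := by
  have e0 : (0 : Fin 2).removeNth ![u, v] = ![v] := by ext i : 1; fin_cases i; rfl
  have e1 : (1 : Fin 2).removeNth ![u, v] = ![u] := by ext i : 1; fin_cases i; rfl
  rw [ContinuousAlternatingMap.alternatizeUncurryFin_apply]
  simp [Fin.sum_univ_succ, e0, e1, sub_eq_add_neg]

theorem alternatizeUncurryFin_two (f : E4 →L[ℝ] Cov 2) (u v w : E4) :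
    ContinuousAlternatingMap.alternatizeUncurryFin f ![u, v, w] =
      f u ![v, w] - f v ![u, w] + f w ![u, v] := by
  have e0 : (0 : Fin 3).removeNth ![u, v, w] = ![v, w] := by ext i : 1; fin_cases i <;> rfl
  have e1 : (1 : Fin 3).removeNth ![u, v, w] = ![u, w] := by ext i : 1; fin_cases i <;> rfl
  have e2 : (2 : Fin 3).removeNth ![u, v, w] = ![u, v] := by ext i : 1; fin_cases i <;> rfl
  rw [ContinuousAlternatingMap.alternatizeUncurryFin_apply]
  simp [Fin.sum_univ_three, e0, e1, e2, sub_eq_add_neg]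

theorem alternatizeUncurryFin_three (f : E4 →L[ℝ] Cov 3) (u v w z : E4) :
    ContinuousAlternatingMap.alternatizeUncurryFin f ![u, v, w, z] =
      f u ![v, w, z] - f v ![u, w, z] + f w ![u, v, z] - f z ![u, v, w] := by
  have e0 : (0 : Fin 4).removeNth ![u, v, w, z] = ![v, w, z] := by
    ext i : 1; fin_cases i <;> rfl
  have e1 : (1 : Fin 4).removeNth ![u, v, w, z] = ![u, w, z] := by
    ext i : 1; fin_cases i <;> rfl
  have e2 : (2 : Fin 4).removeNth ![u, v, w, z] = ![u, v, z] := by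
    ext i : 1; fin_cases i <;> rfl
  have e3 : (3 : Fin 4).removeNth ![u, v, w, z] = ![u, v, w] := by
    ext i : 1; fin_cases i <;> rfl
  rw [ContinuousAlternatingMap.alternatizeUncurryFin_apply]
  simp [Fin.sum_univ_four, e0, e1, e2, e3, sub_eq_add_neg, pow_succ]

theorem wedge_eq_wedgeL {p q n : ℕ} (h : p + q = n) (α : Form p) (β : Form q) :
    wedge h α β = fun x => wedgeL h (α x) (β x) := rfl

theorem hasFDerivAt_wedge {p q n : ℕ} (h : p + q = n) {α : Form p} {β : Form q} {x : E4}
    (hα : DifferentiableAt ℝ α x) (hβ : DifferentiableAt ℝ β x) :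
    HasFDerivAt (wedge h α β) ((wedgeL h).precompR E4 (α x) (fderiv ℝ β x) +
      (wedgeL h).precompL E4 (fderiv ℝ α x) (β x)) x :=
  (wedgeL h).hasFDerivAt_of_bilinear hα.hasFDerivAt hβ.hasFDerivAt

theorem fderiv_wedge_apply {p q n : ℕ} (h : p + q = n) {α : Form p} {β : Form q} {x : E4}
    (hα : DifferentiableAt ℝ α x) (hβ : DifferentiableAt ℝ β x) (u : E4) :
    fderiv ℝ (wedge h α β) x u =
      wedgeCov h (α x) (fderiv ℝ β x u) + wedgeCov h (fderiv ℝ α x u) (β x) := by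
  rw [(hasFDerivAt_wedge h hα hβ).fderiv]
  rfl

theorem extDeriv_wedge_one_one (h : 1 + 1 = 2) {α β : Form 1} {x : E4}
    (hα : DifferentiableAt ℝ α x) (hβ : DifferentiableAt ℝ β x) (u v w : E4) :
    extDeriv (wedge h α β) x ![u, v, w] =
      wedgeCov (n := 3) rfl (extDeriv α x) (β x) ![u, v, w] -
        wedgeCov (n := 3) rfl (α x) (extDeriv β x) ![u, v, w] := by
  rw [wedgeCov_one_two, wedgeCov_two_one]
  simp only [extDeriv, alternatizeUncurryFin_two, alternatizeUncurryFin_one,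
    fderiv_wedge_apply h hα hβ, ContinuousAlternatingMap.add_apply, wedgeCov_one_one]
  ring

/-- The graded Leibniz rule; the bracket being subtracted is α ∧ dB, expanded on four vectors. -/
theorem extDeriv_wedge_one_two (h : 1 + 2 = 3) {α : Form 1} {B : Form 2} {x : E4}
    (hα : DifferentiableAt ℝ α x) (hB : DifferentiableAt ℝ B x) (u v w z : E4) :
    extDeriv (wedge h α B) x ![u, v, w, z] =
      wedgeCov (n := 4) rfl (extDeriv α x) (B x) ![u, v, w, z] -
        (α x ![u] * extDeriv B x ![v, w, z] - α x ![v] * extDeriv B x ![u, w, z] +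
          α x ![w] * extDeriv B x ![u, v, z] - α x ![z] * extDeriv B x ![u, v, w]) := by
  rw [wedgeCov_two_two]
  simp only [extDeriv, alternatizeUncurryFin_three, alternatizeUncurryFin_two,
    alternatizeUncurryFin_one, fderiv_wedge_apply h hα hB, ContinuousAlternatingMap.add_apply,
    wedgeCov_one_two]
  ring

theorem cov_three_ext {α β : Cov 3} (h : ∀ u v w, α ![u, v, w] = β ![u, v, w]) : α = β := by
  ext v
  have e : v = ![v 0, v 1, v 2] := by ext i : 1; fin_cases i <;> rfl
  rw [e]
  exact h _ _ _

theorem isOpen_M : IsOpen M :=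
  (isOpen_lt continuous_const continuous_norm).inter (isOpen_lt continuous_norm continuous_const)

theorem contDiffOn_wedge {p q n : ℕ} (h : p + q = n) {k : WithTop ℕ∞} {s : Set E4} {α : Form p}
    {β : Form q} (hα : ContDiffOn ℝ k α s) (hβ : ContDiffOn ℝ k β s) :
    ContDiffOn ℝ k (wedge h α β) s := by
  rw [wedge_eq_wedgeL]
  exact ((wedgeL h).contDiff.comp_contDiffOn hα).clm_apply hβ

theorem contDiffOn_extDeriv {p : ℕ} {s : Set E4} (hs : IsOpen s) {α : Form p}
    (hα : ContDiffOn ℝ ∞ α s) : ContDiffOn ℝ ∞ (extDeriv α) s :=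
  (ContinuousAlternatingMap.alternatizeUncurryFinCLM ℝ E4 ℂ).contDiff.comp_contDiffOn
    (hα.fderiv_of_isOpen hs (by simp))

/-! ### Algebra of spinor-valued forms -/

theorem wedgeCov_smul_left {p q n : ℕ} (h : p + q = n) (c : ℂ) (α : Cov p) (β : Cov q) :
    wedgeCov h (c • α) β = c • wedgeCov h α β := by
  subst h; ext v
  simp only [wedgeCov_apply, ContinuousAlternatingMap.smul_apply, smul_mul_assoc,
    smul_comm _ c, ← Finset.smul_sum]

theorem wedgeCov_smul_right {p q n : ℕ} (h : p + q = n) (c : ℂ) (α : Cov p) (β : Cov q) :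
    wedgeCov h α (c • β) = c • wedgeCov h α β := by
  subst h; ext v
  simp only [wedgeCov_apply, ContinuousAlternatingMap.smul_apply, mul_smul_comm,
    smul_comm _ c, ← Finset.smul_sum]

theorem wedgeCov_add_left {p q n : ℕ} (h : p + q = n) (α α' : Cov p) (β : Cov q) :
    wedgeCov h (α + α') β = wedgeCov h α β + wedgeCov h α' β :=
  (wedgeL h).map_add₂ α α' β

theorem wedgeCov_add_right {p q n : ℕ} (h : p + q = n) (α : Cov p) (β β' : Cov q) :
    wedgeCov h α (β + β') = wedgeCov h α β + wedgeCov h α β' :=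
  (wedgeL h α).map_add β β'

theorem wedgeCov_neg_right {p q n : ℕ} (h : p + q = n) (α : Cov p) (β : Cov q) :
    wedgeCov h α (-β) = -wedgeCov h α β :=
  (wedgeL h α).map_neg β

theorem wedgeCov_neg_left {p q n : ℕ} (h : p + q = n) (α : Cov p) (β : Cov q) :
    wedgeCov h (-α) β = -wedgeCov h α β :=
  (wedgeL h).map_neg₂ α β

theorem eps_zero_zero : eps 0 0 = 0 := rfl
theorem eps_zero_one : eps 0 1 = 1 := rfl
theorem eps_one_zero : eps 1 0 = -1 := rfl
theorem eps_one_one : eps 1 1 = 0 := rfl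

theorem lower_zero_zero {p : ℕ} (X : SForm p) : lower X 0 0 = X 1 1 := by
  ext x v; simp [lower, eps_zero_zero, eps_one_zero]

theorem lower_zero_one {p : ℕ} (X : SForm p) : lower X 0 1 = -X 1 0 := by
  ext x v; simp [lower, eps_zero_zero, eps_one_zero, eps_zero_one, eps_one_one]

theorem lower_one_zero {p : ℕ} (X : SForm p) : lower X 1 0 = -X 0 1 := by
  ext x v; simp [lower, eps_zero_zero, eps_one_zero, eps_zero_one, eps_one_one]

theorem lower_one_one {p : ℕ} (X : SForm p) : lower X 1 1 = X 0 0 := by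
  ext x v; simp [lower, eps_zero_one, eps_one_one]

theorem raiseFirst_zero {p : ℕ} (X : SForm p) (B : Fin 2) : raiseFirst X 0 B = X 1 B := by
  ext x v; simp [raiseFirst, eps_zero_zero, eps_zero_one]

theorem raiseFirst_one {p : ℕ} (X : SForm p) (B : Fin 2) : raiseFirst X 1 B = -X 0 B := by
  ext x v; simp [raiseFirst, eps_one_zero, eps_one_one]

theorem actLower_eq {p : ℕ} (Γ : SForm 1) (X : SForm p) (A B : Fin 2) (x : E4) :
    actLower Γ X A B x =
      wedge (Nat.add_comm 1 p) (Γ 0 A) (X 1 B) x - wedge (Nat.add_comm 1 p) (Γ 1 A) (X 0 B) x +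
      (wedge (Nat.add_comm 1 p) (Γ 0 B) (X 1 A) x -
        wedge (Nat.add_comm 1 p) (Γ 1 B) (X 0 A) x) := by
  simp only [actLower, Fin.sum_univ_two, raiseFirst_zero, raiseFirst_one, wedge, Pi.neg_apply,
    wedgeCov_neg_right]
  abel

theorem actUpper_eq {p : ℕ} (Γ : SForm 1) (X : SForm p) (x : E4) :
    actUpper Γ X 0 0 x = (2 : ℕ) • (wedge (Nat.add_comm 1 p) (Γ 1 0) (X 0 0) x +
      wedge (Nat.add_comm 1 p) (Γ 1 1) (X 0 1) x) ∧
    actUpper Γ X 0 1 x = wedge (Nat.add_comm 1 p) (Γ 1 0) (X 1 0) x +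
      wedge (Nat.add_comm 1 p) (Γ 1 1) (X 1 1) x - wedge (Nat.add_comm 1 p) (Γ 0 0) (X 0 0) x -
      wedge (Nat.add_comm 1 p) (Γ 0 1) (X 0 1) x ∧
    actUpper Γ X 1 0 x = wedge (Nat.add_comm 1 p) (Γ 1 0) (X 1 0) x +
      wedge (Nat.add_comm 1 p) (Γ 1 1) (X 1 1) x - wedge (Nat.add_comm 1 p) (Γ 0 0) (X 0 0) x -
      wedge (Nat.add_comm 1 p) (Γ 0 1) (X 0 1) x ∧
    actUpper Γ X 1 1 x = -((2 : ℕ) • (wedge (Nat.add_comm 1 p) (Γ 0 0) (X 1 0) x +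
      wedge (Nat.add_comm 1 p) (Γ 0 1) (X 1 1) x)) := by
  simp only [actUpper, Fin.sum_univ_two, raiseFirst_zero, raiseFirst_one, wedge, Pi.neg_apply,
    wedgeCov_neg_left]
  refine ⟨?_, ?_, ?_, ?_⟩ <;> abel

theorem curvature_eq_wedge (Γ : SForm 1) (A B : Fin 2) (x : E4) :
    curvature Γ A B x = extDeriv (Γ A B) x +
      (wedge rfl (Γ 0 A) (Γ 1 B) x - wedge rfl (Γ 1 A) (Γ 0 B) x) := by
  simp only [curvature, Fin.sum_univ_two, raiseFirst_zero, raiseFirst_one, wedge, Pi.neg_apply,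
    wedgeCov_neg_right, sub_eq_add_neg]

theorem contract_eq {p q n : ℕ} (h : p + q = n) (X : SForm p) (Y : SForm q) (x : E4) :
    contract h X Y x = wedge h (X 0 0) (Y 0 0) x + wedge h (X 0 1) (Y 0 1) x +
      (wedge h (X 1 0) (Y 1 0) x + wedge h (X 1 1) (Y 1 1) x) := by
  simp only [contract, Fin.sum_univ_two]

theorem weylForm_eq (ψ : Spinor4) (S : SForm 2) (A B : Fin 2) (x : E4) :
    weylForm ψ S A B x = ψ x ![A, B, 0, 0] • S 0 0 x + ψ x ![A, B, 0, 1] • S 0 1 x +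
      (ψ x ![A, B, 1, 0] • S 1 0 x + ψ x ![A, B, 1, 1] • S 1 1 x) := by
  simp only [weylForm, Fin.sum_univ_two]

/-- A totally symmetric array of four spinor indices. -/
def IsSymmSpinor (φ : (Fin 4 → Fin 2) → ℂ) : Prop :=
  ∀ (π : Equiv.Perm (Fin 4)) (I : Fin 4 → Fin 2), φ (I ∘ π) = φ I

theorem IsSymmSpinor.swap {φ : (Fin 4 → Fin 2) → ℂ} (h : IsSymmSpinor φ) (a b c d : Fin 2) :
    φ ![b, a, c, d] = φ ![a, b, c, d] ∧ φ ![a, c, b, d] = φ ![a, b, c, d] ∧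
      φ ![a, b, d, c] = φ ![a, b, c, d] := by
  refine ⟨?_, ?_, ?_⟩
  · rw [← h (Equiv.swap 0 1) ![a, b, c, d]]
    congr 1; ext i : 1; fin_cases i <;> rfl
  · rw [← h (Equiv.swap 1 2) ![a, b, c, d]]
    congr 1; ext i : 1; fin_cases i <;> rfl
  · rw [← h (Equiv.swap 2 3) ![a, b, c, d]]
    congr 1; ext i : 1; fin_cases i <;> rfl

/-- A symmetric four-index spinor has only five independent components; adjacent transpositions
bring every index list to increasing order. -/
theorem IsSymmSpinor.sorted {φ : (Fin 4 → Fin 2) → ℂ} (h : IsSymmSpinor φ) :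
    (φ ![0, 0, 1, 0] = φ ![0, 0, 0, 1] ∧ φ ![0, 1, 0, 0] = φ ![0, 0, 0, 1] ∧
      φ ![1, 0, 0, 0] = φ ![0, 0, 0, 1]) ∧
    (φ ![0, 1, 0, 1] = φ ![0, 0, 1, 1] ∧ φ ![0, 1, 1, 0] = φ ![0, 0, 1, 1] ∧
      φ ![1, 0, 0, 1] = φ ![0, 0, 1, 1] ∧ φ ![1, 0, 1, 0] = φ ![0, 0, 1, 1] ∧
      φ ![1, 1, 0, 0] = φ ![0, 0, 1, 1]) ∧
    φ ![1, 0, 1, 1] = φ ![0, 1, 1, 1] ∧ φ ![1, 1, 0, 1] = φ ![0, 1, 1, 1] ∧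
      φ ![1, 1, 1, 0] = φ ![0, 1, 1, 1] := by
  have h1 := fun a b c d => (h.swap a b c d).1
  have h2 := fun a b c d => (h.swap a b c d).2.1
  have h3 := fun a b c d => (h.swap a b c d).2.2
  have a1 := h3 0 0 0 1
  have a2 := (h2 0 0 1 0).trans a1
  have a3 := (h1 0 1 0 0).trans a2
  have b1 := h2 0 0 1 1
  have b2 := (h3 0 1 0 1).trans b1
  have b3 := (h1 0 1 0 1).trans b1
  have b4 := (h1 0 1 1 0).trans b2
  have b5 := (h2 1 0 1 0).trans b4
  have c1 := h1 0 1 1 1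
  have c2 := (h2 1 0 1 1).trans c1
  have c3 := (h3 1 1 0 1).trans c2
  exact ⟨⟨a1, a2, a3⟩, ⟨b1, b2, b3, b4, b5⟩, c1, c2, c3⟩

theorem sum_fin_succ_fun {n : ℕ} (f : (Fin (n + 1) → Fin 2) → ℂ) :
    ∑ I, f I = ∑ a, ∑ I : Fin n → Fin 2, f (Matrix.vecCons a I) := by
  rw [← (Fin.consEquiv fun _ : Fin (n + 1) => Fin 2).sum_comp, Fintype.sum_prod_type]
  rfl

theorem sum_fin_four_fun (f : (Fin 4 → Fin 2) → ℂ) :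
    ∑ I, f I = ∑ a, ∑ b, ∑ c, ∑ d, f ![a, b, c, d] := by
  simp only [sum_fin_succ_fun, Fintype.sum_unique]
  rfl

/-- Each ε pairs a 0 with a 1. The coefficients 1, 4, 6 count the index lists with a given number of
ones, and the sign is the parity of that number. -/
theorem contract4_eq {φ χ : (Fin 4 → Fin 2) → ℂ} (hφ : IsSymmSpinor φ) (hχ : IsSymmSpinor χ) :
    contract4 φ χ = φ ![0, 0, 0, 0] * χ ![1, 1, 1, 1] + φ ![1, 1, 1, 1] * χ ![0, 0, 0, 0] -
      4 * (φ ![0, 0, 0, 1] * χ ![0, 1, 1, 1] + φ ![0, 1, 1, 1] * χ ![0, 0, 0, 1]) +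
      6 * (φ ![0, 0, 1, 1] * χ ![0, 0, 1, 1]) := by
  obtain ⟨⟨a1, a2, a3⟩, ⟨b1, b2, b3, b4, b5⟩, c1, c2, c3⟩ := hφ.sorted
  obtain ⟨⟨a1', a2', a3'⟩, ⟨b1', b2', b3', b4', b5'⟩, c1', c2', c3'⟩ := hχ.sorted
  simp only [contract4, sum_fin_four_fun, Fin.prod_univ_four, Fin.sum_univ_two,
    Matrix.cons_val]
  simp only [eps_zero_zero, eps_zero_one, eps_one_zero, eps_one_one, zero_mul, mul_zero,
    add_zero, zero_add, one_mul, mul_one, a1, a2, a3, b1, b2, b3, b4, b5, c1, c2, c3, a1', a2', a3',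
    b1', b2', b3', b4', b5', c1', c2', c3']
  ring

/-! ### Pointwise consequences of the field equations -/

/-- The coefficient of the wedge product of two `2`-covectors. -/
def pair (A B : Cov 2) : ℂ := topCoeff (wedgeCov rfl A B)

theorem stdB_eq : stdB = ![stdB 0, stdB 1, stdB 2, stdB 3] := by
  ext i : 1; fin_cases i <;> rfl

theorem topCoeff_eq (μ : Cov 4) : topCoeff μ = μ ![stdB 0, stdB 1, stdB 2, stdB 3] :=
  congrArg μ stdB_eq

theorem pair_comm (A B : Cov 2) : pair A B = pair B A := by
  simp only [pair, topCoeff_eq, wedgeCov_two_two]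
  ring

theorem pair_add_left (A B C : Cov 2) : pair (A + B) C = pair A C + pair B C := by
  simp only [pair, wedgeCov_add_left]; rfl

theorem pair_add_right (A B C : Cov 2) : pair A (B + C) = pair A B + pair A C := by
  simp only [pair, wedgeCov_add_right]; rfl

theorem pair_smul_left (c : ℂ) (A B : Cov 2) : pair (c • A) B = c * pair A B := by
  simp only [pair, wedgeCov_smul_left]; rfl

theorem pair_smul_right (c : ℂ) (A B : Cov 2) : pair A (c • B) = c * pair A B := by
  simp only [pair, wedgeCov_smul_right]; rfl

theorem pair_neg_left (A B : Cov 2) : pair (-A) B = -pair A B := by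
  simp only [pair, wedgeCov_neg_left]; rfl

theorem topCoeff_add (μ ν : Cov 4) : topCoeff (μ + ν) = topCoeff μ + topCoeff ν := rfl

theorem topCoeff_smul (c : ℂ) (μ : Cov 4) : topCoeff (c • μ) = c * topCoeff μ := rfl

/-- The components of `X^{(AB} ∧ Y^{CD)} = 0`. -/
theorem pair_of_symWedge_eq_zero {X Y : SForm 2} {x : E4} (hX : X 1 0 x = X 0 1 x)
    (hY : Y 1 0 x = Y 0 1 x) (h : ∀ I, symWedge X Y I x = 0) :
    pair (X 0 0 x) (Y 0 0 x) = 0 ∧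
    pair (X 0 0 x) (Y 0 1 x) + pair (X 0 1 x) (Y 0 0 x) = 0 ∧
    pair (X 0 0 x) (Y 1 1 x) + 4 * pair (X 0 1 x) (Y 0 1 x) + pair (X 1 1 x) (Y 0 0 x) = 0 ∧
    pair (X 0 1 x) (Y 1 1 x) + pair (X 1 1 x) (Y 0 1 x) = 0 ∧
    pair (X 1 1 x) (Y 1 1 x) = 0 := by
  have key (I : Fin 4 → Fin 2) := (sum_perm_fin_four fun _ i j k l =>
    pair (X (I i) (I j) x) (Y (I k) (I l) x)).symm.trans
      (show _ = (0 : ℂ) from by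
        have := congrArg topCoeff (h I)
        simp only [symWedge, topCoeff, ContinuousAlternatingMap.sum_apply] at this
        exact this)
  have k0 := key ![0, 0, 0, 0]
  have k1 := key ![0, 0, 0, 1]
  have k2 := key ![0, 0, 1, 1]
  have k3 := key ![0, 1, 1, 1]
  have k4 := key ![1, 1, 1, 1]
  simp only [Matrix.cons_val, hX, hY] at k0 k1 k2 k3 k4
  -- The divisors are multiplicities among the 24 permutations: 24 for constant lists, 12 for each
  -- ordered pair of components in 0001 and 0111. In 0011 they are 4, 16, 4, hence the relative
  -- factor 4.
  refine ⟨?_, ?_, ?_, ?_, ?_⟩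
  · linear_combination k0 / 24
  · linear_combination k1 / 12
  · linear_combination k2 / 4
  · linear_combination k3 / 12
  · linear_combination k4 / 24

/-- Simplicity gives Σ^{01} ∧ Σ^{01} = -½ Σ^{00} ∧ Σ^{11}, so the contraction Σ^{AB} ∧ Σ_{AB}
collapses to 3 Σ^{00} ∧ Σ^{11}. -/
theorem topCoeff_volForm (S : SForm 2) {x : E4} (hS : S 1 0 x = S 0 1 x)
    (h : ∀ I, symWedge S S I x = 0) :
    topCoeff (volForm S x) = pair (S 0 0 x) (S 1 1 x) / 2 := by
  obtain ⟨-, -, h2, -, -⟩ := pair_of_symWedge_eq_zero hS hS h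
  have e : topCoeff (volForm S x) = (1 / 6) * (pair (S 0 0 x) (S 1 1 x) +
      -pair (S 0 1 x) (S 0 1 x) + (-pair (S 0 1 x) (S 0 1 x) + pair (S 1 1 x) (S 0 0 x))) := by
    simp only [volForm, topCoeff_smul, contract_eq, topCoeff_add, wedge, lower_zero_zero,
      lower_zero_one, lower_one_zero, lower_one_one, Pi.neg_apply, hS, wedgeCov_neg_right, pair]
    rfl
  rw [e]
  have h3 := pair_comm (S 1 1 x) (S 0 0 x)
  linear_combination (-1 / 12) * h2 + (1 / 4) * h3

theorem weylForm_symm {ψ : Spinor4} {x : E4} (hψ : IsSymmSpinor (ψ x)) (S : SForm 2) :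
    weylForm ψ S 1 0 x = weylForm ψ S 0 1 x := by
  simp only [weylForm_eq, (hψ.swap 0 1 _ _).1]

/-- `σ^{AB} ∧ ψ_{ABCD} Σ^{CD} = 0` for symmetric `ψ`, if `σ^{(AB} ∧ Σ^{CD)} = 0`. -/
theorem pair_weylForm_eq_zero {ψ : Spinor4} {σ S : SForm 2} {x : E4}
    (hψ : IsSymmSpinor (ψ x)) (hσ : σ 1 0 x = σ 0 1 x) (hS : S 1 0 x = S 0 1 x)
    (h : ∀ I, symWedge σ S I x = 0) :
    pair (σ 0 0 x) (weylForm ψ S 0 0 x) + 2 * pair (σ 0 1 x) (weylForm ψ S 0 1 x) +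
      pair (σ 1 1 x) (weylForm ψ S 1 1 x) = 0 := by
  obtain ⟨k0, k1, k2, k3, k4⟩ := pair_of_symWedge_eq_zero hσ hS h
  obtain ⟨⟨a1, a2, a3⟩, ⟨b1, b2, b3, b4, b5⟩, c1, c2, c3⟩ := hψ.sorted
  simp only [weylForm_eq, hS, a1, a2, b1, b2, b5, c2, c3,
    pair_add_right, pair_smul_right]
  linear_combination (ψ x ![0, 0, 0, 0]) * k0 + 2 * (ψ x ![0, 0, 0, 1]) * k1 +
    (ψ x ![0, 0, 1, 1]) * k2 + 2 * (ψ x ![0, 1, 1, 1]) * k3 + (ψ x ![1, 1, 1, 1]) * k4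

/-- `ψ_{ABCD} Σ^{CD} ∧ φ^{AB}{}_{EF} Σ^{EF} = 2 ψ^{ABCD} φ_{ABCD} dμ`. -/
theorem pair_weylForm_weylForm {φ ψ : Spinor4} {S : SForm 2} {x : E4}
    (hφ : IsSymmSpinor (φ x)) (hψ : IsSymmSpinor (ψ x)) (hS : S 1 0 x = S 0 1 x)
    (h : ∀ I, symWedge S S I x = 0) :
    pair (weylForm φ S 0 0 x) (weylForm ψ S 1 1 x) -
      2 * pair (weylForm φ S 0 1 x) (weylForm ψ S 0 1 x) +
      pair (weylForm φ S 1 1 x) (weylForm ψ S 0 0 x) =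
    2 * (contract4 (φ x) (ψ x) * topCoeff (volForm S x)) := by
  obtain ⟨k0, k1, k2, k3, k4⟩ := pair_of_symWedge_eq_zero hS hS h
  rw [pair_comm (S 0 1 x) (S 0 0 x), ← two_mul] at k1
  rw [pair_comm (S 1 1 x) (S 0 0 x)] at k2
  rw [pair_comm (S 1 1 x) (S 0 1 x), ← two_mul] at k3
  -- Simplicity fixes the Gram matrix of (Σ^{00}, Σ^{01}, Σ^{11}) under the wedge pairing up to one
  -- scale, Σ^{00} ∧ Σ^{11} = 2 dμ.
  have k1' : pair (S 0 0 x) (S 0 1 x) = 0 := by linear_combination k1 / 2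
  have k3' : pair (S 0 1 x) (S 1 1 x) = 0 := by linear_combination k3 / 2
  have k2' : pair (S 0 1 x) (S 0 1 x) = -pair (S 0 0 x) (S 1 1 x) / 2 := by
    linear_combination k2 / 4
  obtain ⟨⟨a1, a2, a3⟩, ⟨b1, b2, b3, b4, b5⟩, c1, c2, c3⟩ := hφ.sorted
  obtain ⟨⟨a1', a2', a3'⟩, ⟨b1', b2', b3', b4', b5'⟩, c1', c2', c3'⟩ := hψ.sorted
  rw [topCoeff_volForm S hS h, contract4_eq hφ hψ]
  simp only [weylForm_eq, hS, a1, a2, b1, b2, b5, c2, c3, a1', a2', b1', b2', b5', c2', c3',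
    pair_add_right, pair_smul_right, pair_add_left, pair_smul_left,
    pair_comm (S 0 1 x) (S 0 0 x), pair_comm (S 1 1 x) (S 0 0 x), pair_comm (S 1 1 x) (S 0 1 x),
    k0, k1', k2', k3', k4]
  ring

/-! ### Exterior derivatives of the fields -/

/-- The degree of `actLower` and `actUpper` is literally `p + 1`; this variant and the next have
that unreduced degree, so that `simp` can match it. -/
theorem wedgeCov_one_one' (h : 1 + 1 = 1 + 1) (α β : Cov 1) (u v : E4) :
    wedgeCov h α β ![u, v] = α ![u] * β ![v] - α ![v] * β ![u] :=
  wedgeCov_one_one h α β u v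

theorem wedgeCov_one_two' (h : 1 + 2 = 2 + 1) (α : Cov 1) (B : Cov 2) (u v w : E4) :
    wedgeCov h α B ![u, v, w] =
      α ![u] * B ![v, w] - α ![v] * B ![u, w] + α ![w] * B ![u, v] :=
  wedgeCov_one_two h α B u v w

theorem extDeriv_sub' {p : ℕ} {α β : Form p} {x : E4} (hα : DifferentiableAt ℝ α x)
    (hβ : DifferentiableAt ℝ β x) :
    extDeriv (fun y => α y - β y) x = extDeriv α x - extDeriv β x := by
  rw [extDeriv, fderiv_fun_sub hα hβ]
  exact map_sub (ContinuousAlternatingMap.alternatizeUncurryFinCLM ℝ E4 ℂ (n := p)) _ _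

theorem extDeriv_complex_smul {p : ℕ} {α : Form p} {x : E4} (c : ℂ)
    (hα : DifferentiableAt ℝ α x) :
    extDeriv (fun y => c • α y) x = c • extDeriv α x := by
  ext v
  rw [extDeriv, fderiv_fun_const_smul hα]
  simp [extDeriv, ContinuousAlternatingMap.alternatizeUncurryFin_apply, Finset.mul_sum]

theorem extDeriv_neg' {p : ℕ} (α : Form p) (x : E4) : extDeriv (-α) x = -extDeriv α x := by
  rw [extDeriv, fderiv_neg]
  exact map_neg (ContinuousAlternatingMap.alternatizeUncurryFinCLM ℝ E4 ℂ (n := p)) _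

theorem two_le_smoothness : minSmoothness ℝ 2 ≤ (∞ : WithTop ℕ∞) := by
  rw [minSmoothness_of_isRCLikeNormedField]
  exact WithTop.coe_le_coe.2 (le_top : (2 : ℕ∞) ≤ ⊤)

theorem contDiffOn_lower {p : ℕ} {X : SForm p} {s : Set E4}
    (hX : ∀ A B, ContDiffOn ℝ ∞ (X A B) s) (A B : Fin 2) : ContDiffOn ℝ ∞ (lower X A B) s := by
  revert A B
  simp only [Fin.forall_fin_two, lower_zero_zero, lower_zero_one, lower_one_zero, lower_one_one]
  exact ⟨⟨hX 1 1, (hX 1 0).neg⟩, (hX 0 1).neg, hX 0 0⟩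

theorem differentiableAt_of_contDiffOn_M {p : ℕ} {α : Form p} (h : ContDiffOn ℝ ∞ α M) {x : E4}
    (hx : x ∈ M) : DifferentiableAt ℝ α x :=
  (h.contDiffAt (isOpen_M.mem_nhds hx)).differentiableAt (by simp)

section
variable {Λ : ℝ} {S : SForm 2} {Γ : SForm 1} {Ω : E4 → ℝ} {h : Perturbation}

theorem weylForm_eq_covD (hh : IsScatteringState Λ S Γ Ω h) {x : E4} (hx : x ∈ M) (A B : Fin 2) :
    weylForm h.ψ S A B x = extDeriv (h.γ A B) x +
      (wedge rfl (Γ 0 A) (h.γ 1 B) x - wedge rfl (Γ 1 A) (h.γ 0 B) x +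
        (wedge rfl (Γ 0 B) (h.γ 1 A) x - wedge rfl (Γ 1 B) (h.γ 0 A) x)) -
      ((Λ / 3 : ℝ) : ℂ) • lower h.σ A B x := by
  rw [← actLower_eq, eq_sub_iff_add_eq]
  exact (hh.lin_curvature A B x hx).symm

/-- `D₀ (ψ_{ABCD} Σ₀^{CD}) = 0`. -/
theorem extDeriv_weylForm (hbg : IsSelfDualBackground Λ S Γ) (hh : IsScatteringState Λ S Γ Ω h)
    {x : E4} (hx : x ∈ M) (A B : Fin 2) :
    extDeriv (weylForm h.ψ S A B) x = -actLower Γ (weylForm h.ψ S) A B x := by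
  have dΓ (A B) : DifferentiableAt ℝ (Γ A B) x :=
    differentiableAt_of_contDiffOn_M (hbg.smooth_Γ A B) hx
  have dγ (A B) : DifferentiableAt ℝ (h.γ A B) x :=
    differentiableAt_of_contDiffOn_M (hh.smooth_γ A B) hx
  have dσ (A B) : DifferentiableAt ℝ (lower h.σ A B) x :=
    differentiableAt_of_contDiffOn_M (contDiffOn_lower hh.smooth_σ A B) hx
  have ddγ (A B) : DifferentiableAt ℝ (extDeriv (h.γ A B)) x :=
    differentiableAt_of_contDiffOn_M (contDiffOn_extDeriv isOpen_M (hh.smooth_γ A B)) hx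
  have dw (A B C D) : DifferentiableAt ℝ (wedge rfl (Γ A B) (h.γ C D) : Form 2) x :=
    (hasFDerivAt_wedge rfl (dΓ A B) (dγ C D)).differentiableAt
  have e1 : extDeriv (weylForm h.ψ S A B) x = extDeriv (wedge rfl (Γ 0 A) (h.γ 1 B) : Form 2) x -
      extDeriv (wedge rfl (Γ 1 A) (h.γ 0 B) : Form 2) x +
      (extDeriv (wedge rfl (Γ 0 B) (h.γ 1 A) : Form 2) x -
        extDeriv (wedge rfl (Γ 1 B) (h.γ 0 A) : Form 2) x) -
      ((Λ / 3 : ℝ) : ℂ) • extDeriv (lower h.σ A B) x := by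
    have ev : weylForm h.ψ S A B =ᶠ[𝓝 x] fun y => (extDeriv (h.γ A B) y +
        (wedge rfl (Γ 0 A) (h.γ 1 B) y - wedge rfl (Γ 1 A) (h.γ 0 B) y +
          (wedge rfl (Γ 0 B) (h.γ 1 A) y - wedge rfl (Γ 1 B) (h.γ 0 A) y)) : Cov 2) -
        ((Λ / 3 : ℝ) : ℂ) • lower h.σ A B y := by
      filter_upwards [isOpen_M.mem_nhds hx] with y hy using weylForm_eq_covD hh hy A B
    rw [ev.extDeriv_eq, extDeriv_sub' (((ddγ A B).fun_add (((dw 0 A 1 B).fun_sub (dw 1 A 0 B)).fun_add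
        ((dw 0 B 1 A).fun_sub (dw 1 B 0 A))))) ((dσ A B).fun_const_smul _),
      extDeriv_fun_add (ddγ A B) (((dw 0 A 1 B).fun_sub (dw 1 A 0 B)).fun_add
        ((dw 0 B 1 A).fun_sub (dw 1 B 0 A))),
      extDeriv_fun_add ((dw 0 A 1 B).fun_sub (dw 1 A 0 B)) ((dw 0 B 1 A).fun_sub (dw 1 B 0 A)),
      extDeriv_sub' (dw 0 A 1 B) (dw 1 A 0 B), extDeriv_sub' (dw 0 B 1 A) (dw 1 B 0 A),
      extDeriv_complex_smul _ (dσ A B),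
      extDeriv_extDeriv_apply ((hh.smooth_γ A B).contDiffAt (isOpen_M.mem_nhds hx)) two_le_smoothness, zero_add]
  have hΓ (A B) (u v : E4) : extDeriv (Γ A B) x ![u, v] =
      ((Λ / 3 : ℝ) : ℂ) * lower S A B x ![u, v] -
        (Γ 0 A x ![u] * Γ 1 B x ![v] - Γ 0 A x ![v] * Γ 1 B x ![u] -
          (Γ 1 A x ![u] * Γ 0 B x ![v] - Γ 1 A x ![v] * Γ 0 B x ![u])) := by
    have := congrArg (fun μ : Cov 2 => μ ![u, v])
      ((curvature_eq_wedge Γ A B x).symm.trans (hbg.curvature_eq A B x hx))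
    simp only [ContinuousAlternatingMap.add_apply, ContinuousAlternatingMap.sub_apply,
      ContinuousAlternatingMap.smul_apply, wedge, wedgeCov_one_one', smul_eq_mul] at this
    linear_combination this
  have hσ (A B) : extDeriv (h.σ A B) x = -actUpper h.γ S A B x - actUpper Γ h.σ A B x :=
    eq_sub_iff_add_eq.2 (hh.lin_torsion A B x hx)
  rw [e1]
  apply cov_three_ext
  intro u v w
  simp only [ContinuousAlternatingMap.add_apply, ContinuousAlternatingMap.sub_apply,
      ContinuousAlternatingMap.smul_apply, ContinuousAlternatingMap.neg_apply, smul_eq_mul,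
      extDeriv_wedge_one_one, dΓ, dγ, actLower_eq, wedge, wedgeCov_two_one, wedgeCov_one_two',
      hΓ, weylForm_eq_covD hh hx, wedgeCov_one_one']
  obtain ⟨p1, p2, -, p4⟩ := actUpper_eq h.γ S x
  obtain ⟨q1, q2, -, q4⟩ := actUpper_eq Γ h.σ x
  have sS := hbg.symm_S 1 0
  have sΓ := hbg.symm_Γ 1 0
  have sσ := hh.symm_σ 1 0
  have sγ := hh.symm_γ 1 0
  revert A B
  simp only [Fin.forall_fin_two]
  refine ⟨⟨?_, ?_⟩, ?_, ?_⟩ <;>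
  · intros
    simp only [lower_zero_zero, lower_zero_one, lower_one_zero, lower_one_one, extDeriv_neg', hσ,
      p1, p2, p4, q1, q2, q4, ContinuousAlternatingMap.add_apply,
      ContinuousAlternatingMap.sub_apply,
      ContinuousAlternatingMap.smul_apply, ContinuousAlternatingMap.neg_apply, Pi.neg_apply,
      wedge, wedgeCov_one_two', sS, sΓ, sσ, sγ, nsmul_eq_mul, Nat.cast_ofNat]
    ring

end

theorem contract_lower_eq {p q n : ℕ} (h : p + q = n) (X : SForm p) (Y : SForm q)
    (hX : X 1 0 = X 0 1) (hY : ∀ x, Y 1 0 x = Y 0 1 x) :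
    contract h X (lower Y) = fun x => wedge h (X 0 0) (Y 1 1) x - wedge h (X 0 1) (Y 0 1) x -
      (wedge h (X 0 1) (Y 0 1) x - wedge h (X 1 1) (Y 0 0) x) := by
  ext1 x
  simp only [contract_eq, lower_zero_zero, lower_zero_one, lower_one_zero, lower_one_one, wedge,
    Pi.neg_apply, wedgeCov_neg_right, hX, hY]
  abel

section
variable {Λ : ℝ} {S : SForm 2} {Γ : SForm 1} {Ω : E4 → ℝ} {h h' : Perturbation}

theorem contDiffOn_weylForm (hbg : IsSelfDualBackground Λ S Γ)
    (hh : IsScatteringState Λ S Γ Ω h) (A B : Fin 2) :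
    ContDiffOn ℝ ∞ (weylForm h.ψ S A B) M := by
  have hψ (I) : ContDiffOn ℝ ∞ (fun x => h.ψ x I) M := contDiffOn_pi.1 hh.smooth_ψ I
  exact ContDiffOn.sum fun C _ => ContDiffOn.sum fun D _ => (hψ _).smul (hbg.smooth_S C D)

theorem contDiffOn_contract {p q n : ℕ} (hn : p + q = n) {X : SForm p} {Y : SForm q} {s : Set E4}
    (hX : ∀ A B, ContDiffOn ℝ ∞ (X A B) s) (hY : ∀ A B, ContDiffOn ℝ ∞ (Y A B) s) :
    ContDiffOn ℝ ∞ (contract hn X Y) s :=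
  ContDiffOn.sum fun A _ => ContDiffOn.sum fun B _ => contDiffOn_wedge hn (hX A B) (hY A B)

/-- `d (γ_{AB} ∧ ψ'^{AB}{}_{CD} Σ₀^{CD}) = 2 ψ^{ABCD} ψ'_{ABCD} dμ`. -/
theorem topCoeff_extDeriv_current (hbg : IsSelfDualBackground Λ S Γ)
    (hh : IsScatteringState Λ S Γ Ω h) (hh' : IsScatteringState Λ S Γ Ω h') {x : E4} (hx : x ∈ M) :
    topCoeff (extDeriv (contract (n := 3) rfl h.γ (lower (weylForm h'.ψ S))) x) =
      2 * cgDensity S h h' x := by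
  have dγ (A B) : DifferentiableAt ℝ (h.γ A B) x :=
    differentiableAt_of_contDiffOn_M (hh.smooth_γ A B) hx
  have dΨ (A B) : DifferentiableAt ℝ (weylForm h'.ψ S A B) x :=
    differentiableAt_of_contDiffOn_M (contDiffOn_weylForm hbg hh' A B) hx
  have dw (A B C D) : DifferentiableAt ℝ
      (wedge rfl (h.γ A B) (weylForm h'.ψ S C D) : Form 3) x :=
    (hasFDerivAt_wedge rfl (dγ A B) (dΨ C D)).differentiableAt
  have sγ := hh.symm_γ 1 0
  have sΓ := hbg.symm_Γ 1 0
  have sS := congrFun (hbg.symm_S 1 0) x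
  have sσ := congrFun (hh.symm_σ 1 0) x
  have sΨ := weylForm_symm (hh'.symm_ψ x) S
  have hγ (A B) : extDeriv (h.γ A B) x = weylForm h.ψ S A B x +
      ((Λ / 3 : ℝ) : ℂ) • lower h.σ A B x + -actLower Γ h.γ A B x := by
    rw [← sub_eq_add_neg, eq_sub_iff_add_eq]
    exact hh.lin_curvature A B x hx
  have step (A B C D) : extDeriv (wedge rfl (h.γ A B) (weylForm h'.ψ S C D) : Form 3) x
      ![stdB 0, stdB 1, stdB 2, stdB 3] =
      pair (weylForm h.ψ S A B x) (weylForm h'.ψ S C D x) +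
      ((Λ / 3 : ℝ) : ℂ) * pair (lower h.σ A B x) (weylForm h'.ψ S C D x) -
      (pair (actLower Γ h.γ A B x) (weylForm h'.ψ S C D x) -
      (h.γ A B x ![stdB 0] * actLower Γ (weylForm h'.ψ S) C D x ![stdB 1, stdB 2, stdB 3] -
        h.γ A B x ![stdB 1] * actLower Γ (weylForm h'.ψ S) C D x ![stdB 0, stdB 2, stdB 3] +
        h.γ A B x ![stdB 2] * actLower Γ (weylForm h'.ψ S) C D x ![stdB 0, stdB 1, stdB 3] -
        h.γ A B x ![stdB 3] * actLower Γ (weylForm h'.ψ S) C D x ![stdB 0, stdB 1, stdB 2])) := by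
    rw [extDeriv_wedge_one_two rfl (dγ A B) (dΨ C D), extDeriv_weylForm hbg hh' hx, ← topCoeff_eq]
    change pair (extDeriv (h.γ A B) x) _ - _ = _
    rw [hγ, pair_add_left, pair_add_left, pair_smul_left, pair_neg_left]
    simp only [ContinuousAlternatingMap.neg_apply]
    ring
  have hfun := contract_lower_eq (n := 3) rfl h.γ (weylForm h'.ψ S) sγ
    fun y => weylForm_symm (hh'.symm_ψ y) S
  rw [hfun, extDeriv_sub' ((dw 0 0 1 1).fun_sub (dw 0 1 0 1)) ((dw 0 1 0 1).fun_sub (dw 1 1 0 0)),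
    extDeriv_sub' (dw 0 0 1 1) (dw 0 1 0 1), extDeriv_sub' (dw 0 1 0 1) (dw 1 1 0 0), topCoeff_eq]
  simp only [ContinuousAlternatingMap.sub_apply, step]
  have i1 := pair_weylForm_weylForm (hh.symm_ψ x) (hh'.symm_ψ x) sS (fun I => hbg.simplicity I x hx)
  have i2 := pair_weylForm_eq_zero (hh'.symm_ψ x) sσ sS (fun I => hh.lin_simplicity I x hx)
  -- Invariance of the ε-contraction under the connection: the Γ₀ terms of D₀γ ∧ Ψ' and of γ ∧ D₀Ψ'
  -- cancel, so d may be replaced by D₀. Only the symmetry of Ψ' in its two indices matters, hence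
  -- the generalisation.
  have i3 : pair (actLower Γ h.γ 0 0 x) (weylForm h'.ψ S 1 1 x) -
      2 * pair (actLower Γ h.γ 0 1 x) (weylForm h'.ψ S 0 1 x) +
      pair (actLower Γ h.γ 1 1 x) (weylForm h'.ψ S 0 0 x) =
      (h.γ 0 0 x ![stdB 0] * actLower Γ (weylForm h'.ψ S) 1 1 x ![stdB 1, stdB 2, stdB 3] -
        h.γ 0 0 x ![stdB 1] * actLower Γ (weylForm h'.ψ S) 1 1 x ![stdB 0, stdB 2, stdB 3] +
        h.γ 0 0 x ![stdB 2] * actLower Γ (weylForm h'.ψ S) 1 1 x ![stdB 0, stdB 1, stdB 3] -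
        h.γ 0 0 x ![stdB 3] * actLower Γ (weylForm h'.ψ S) 1 1 x ![stdB 0, stdB 1, stdB 2]) -
      2 * (h.γ 0 1 x ![stdB 0] * actLower Γ (weylForm h'.ψ S) 0 1 x ![stdB 1, stdB 2, stdB 3] -
        h.γ 0 1 x ![stdB 1] * actLower Γ (weylForm h'.ψ S) 0 1 x ![stdB 0, stdB 2, stdB 3] +
        h.γ 0 1 x ![stdB 2] * actLower Γ (weylForm h'.ψ S) 0 1 x ![stdB 0, stdB 1, stdB 3] -
        h.γ 0 1 x ![stdB 3] * actLower Γ (weylForm h'.ψ S) 0 1 x ![stdB 0, stdB 1, stdB 2]) +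
      (h.γ 1 1 x ![stdB 0] * actLower Γ (weylForm h'.ψ S) 0 0 x ![stdB 1, stdB 2, stdB 3] -
        h.γ 1 1 x ![stdB 1] * actLower Γ (weylForm h'.ψ S) 0 0 x ![stdB 0, stdB 2, stdB 3] +
        h.γ 1 1 x ![stdB 2] * actLower Γ (weylForm h'.ψ S) 0 0 x ![stdB 0, stdB 1, stdB 3] -
        h.γ 1 1 x ![stdB 3] * actLower Γ (weylForm h'.ψ S) 0 0 x ![stdB 0, stdB 1, stdB 2]) := by
    generalize weylForm h'.ψ S = Ψ at sΨ
    simp only [pair, topCoeff_eq, wedgeCov_two_two, actLower_eq, ContinuousAlternatingMap.add_apply,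
      ContinuousAlternatingMap.sub_apply, wedge, wedgeCov_one_one', wedgeCov_one_two', sΓ, sγ, sΨ]
    ring
  simp only [lower_zero_zero, lower_zero_one, lower_one_one, Pi.neg_apply, pair_neg_left, sσ]
  rw [cgDensity]
  linear_combination i1 + ((Λ / 3 : ℝ) : ℂ) * i2 - i3

/-- The difference of the two currents is the symplectic current, up to an exact form. -/
theorem current_sub_current (hbg : IsSelfDualBackground Λ S Γ)
    (hh : IsScatteringState Λ S Γ Ω h) (hh' : IsScatteringState Λ S Γ Ω h') {x : E4} (hx : x ∈ M) :
    contract (n := 3) rfl h'.γ (lower (weylForm h.ψ S)) x -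
      contract (n := 3) rfl h.γ (lower (weylForm h'.ψ S)) x =
    extDeriv (contract (n := 2) rfl h.γ (lower h'.γ)) x - ((Λ / 3 : ℝ) : ℂ) •
      (contract (n := 3) rfl h.σ h'.γ x - contract (n := 3) rfl h'.σ h.γ x) := by
  have dγ (A B) : DifferentiableAt ℝ (h.γ A B) x :=
    differentiableAt_of_contDiffOn_M (hh.smooth_γ A B) hx
  have dγ' (A B) : DifferentiableAt ℝ (h'.γ A B) x :=
    differentiableAt_of_contDiffOn_M (hh'.smooth_γ A B) hx
  have dw (A B C D) : DifferentiableAt ℝ (wedge rfl (h.γ A B) (h'.γ C D) : Form 2) x :=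
    (hasFDerivAt_wedge rfl (dγ A B) (dγ' C D)).differentiableAt
  have sγ := hh.symm_γ 1 0
  have sγ' := hh'.symm_γ 1 0
  have sΓ := hbg.symm_Γ 1 0
  have sσ := hh.symm_σ 1 0
  have sσ' := hh'.symm_σ 1 0
  rw [contract_lower_eq (n := 2) rfl h.γ h'.γ sγ (fun y => congrFun sγ' y),
    contract_lower_eq (n := 3) rfl h.γ (weylForm h'.ψ S) sγ
      (fun y => weylForm_symm (hh'.symm_ψ y) S),
    contract_lower_eq (n := 3) rfl h'.γ (weylForm h.ψ S) sγ'
      (fun y => weylForm_symm (hh.symm_ψ y) S),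
    extDeriv_sub' ((dw 0 0 1 1).fun_sub (dw 0 1 0 1)) ((dw 0 1 0 1).fun_sub (dw 1 1 0 0)),
    extDeriv_sub' (dw 0 0 1 1) (dw 0 1 0 1), extDeriv_sub' (dw 0 1 0 1) (dw 1 1 0 0)]
  apply cov_three_ext
  intro u v w
  -- Substituting Ψ = D₀γ - (Λ/3)σ on the left leaves d(γ ∧ γ') = dγ ∧ γ' - γ ∧ dγ' and the σ terms;
  -- the Γ₀ terms cancel by invariance of the contraction.
  simp only [ContinuousAlternatingMap.add_apply, ContinuousAlternatingMap.sub_apply,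
    ContinuousAlternatingMap.smul_apply, smul_eq_mul, contract_eq, wedge,
    extDeriv_wedge_one_one rfl (dγ _ _) (dγ' _ _), wedgeCov_one_two, wedgeCov_two_one,
    weylForm_eq_covD hh hx, weylForm_eq_covD hh' hx, wedgeCov_one_one', lower_zero_zero,
    lower_zero_one, lower_one_one, sγ, sγ', sΓ, sσ, sσ', Pi.neg_apply,
    ContinuousAlternatingMap.neg_apply]
  ring

end

/-! ### Injectivity of the torsion map `γ ↦ γ^{(A}_C ∧ Σ^{B)C}` -/

/-- The skew matrix with the given entries above the diagonal. -/
def skew (p : Fin 6 → ℂ) : Matrix (Fin 4) (Fin 4) ℂ :=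
  !![0, p 0, p 1, p 2; -p 0, 0, p 3, p 4; -p 1, -p 3, 0, p 5; -p 2, -p 4, -p 5, 0]

/-- The Hodge dual of `skew p`. -/
def skewDual (p : Fin 6 → ℂ) : Matrix (Fin 4) (Fin 4) ℂ :=
  skew ![p 5, -p 4, p 3, p 2, -p 1, p 0]

/-- The polarised Pfaffian. -/
def pfaff (p q : Fin 6 → ℂ) : ℂ :=
  p 0 * q 5 - p 1 * q 4 + p 2 * q 3 + p 3 * q 2 - p 4 * q 1 + p 5 * q 0

/-- The polarised form of A·(*A) = -Pf(A)·1 for a skew 4×4 matrix. It is a Clifford relation for the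
wedge pairing on two-forms, and with its mirror image below it is all that the injectivity of the
torsion map needs. -/
theorem skew_mul_skewDual (p q : Fin 6 → ℂ) :
    skew p * skewDual q + skew q * skewDual p = -pfaff p q • (1 : Matrix (Fin 4) (Fin 4) ℂ) := by
  ext i j
  fin_cases i <;> fin_cases j <;>
    simp [skew, skewDual, pfaff] <;> ring

theorem skewDual_skewDual (p : Fin 6 → ℂ) :
    skewDual ![p 5, -p 4, p 3, p 2, -p 1, p 0] = skew p := by
  ext i j
  fin_cases i <;> fin_cases j <;> simp [skewDual, skew]

theorem skewDual_mul_skew (p q : Fin 6 → ℂ) :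
    skewDual p * skew q + skewDual q * skew p = -pfaff p q • (1 : Matrix (Fin 4) (Fin 4) ℂ) := by
  have h := skew_mul_skewDual ![p 5, -p 4, p 3, p 2, -p 1, p 0] ![q 5, -q 4, q 3, q 2, -q 1, q 0]
  rw [skewDual_skewDual, skewDual_skewDual] at h
  refine h.trans ?_
  congr 2
  simp [pfaff]
  ring

/-- Since q is invertible up to scale (`pfaff q q ≠ 0`), the first two equations express c and a
through b. The third becomes a relation on b alone, which the Clifford relations force to be
trivial. Tildes below denote Hodge duals. -/
theorem eq_zero_of_skewDual_mulVec {p q r : Fin 6 → ℂ} {a b c : Fin 4 → ℂ}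
    (hpp : pfaff p p = 0) (hpq : pfaff p q = 0) (hqr : pfaff q r = 0)
    (hpr : pfaff p r = -2 * pfaff q q) (hq : pfaff q q ≠ 0)
    (e₁ : (skewDual p).mulVec b + (skewDual q).mulVec c = 0)
    (e₂ : (skewDual q).mulVec a + (skewDual r).mulVec b = 0)
    (e₃ : (skewDual r).mulVec c = (skewDual p).mulVec a) : a = 0 ∧ b = 0 ∧ c = 0 := by
  have act (x y : Fin 6 → ℂ) (v : Fin 4 → ℂ) : (skew x).mulVec ((skewDual y).mulVec v) +
      (skew y).mulVec ((skewDual x).mulVec v) = -pfaff x y • v := by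
    rw [Matrix.mulVec_mulVec, Matrix.mulVec_mulVec, ← Matrix.add_mulVec, skew_mul_skewDual,
      Matrix.smul_mulVec, Matrix.one_mulVec]
  have act' (x y : Fin 6 → ℂ) (v : Fin 4 → ℂ) : (skewDual x).mulVec ((skew y).mulVec v) +
      (skewDual y).mulVec ((skew x).mulVec v) = -pfaff x y • v := by
    rw [Matrix.mulVec_mulVec, Matrix.mulVec_mulVec, ← Matrix.add_mulVec, skewDual_mul_skew,
      Matrix.smul_mulVec, Matrix.one_mulVec]
  set k := pfaff q q with hk
  have qq (v : Fin 4 → ℂ) : (skew q).mulVec ((skewDual q).mulVec v) = (-k / 2) • v := by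
    have h := act q q v
    rw [← two_smul ℂ, ← hk] at h
    rw [← inv_smul_smul₀ (two_ne_zero' ℂ) ((skew q).mulVec _), h, smul_smul]
    congr 1; ring
  have hc : (k / 2) • c = (skew q).mulVec ((skewDual p).mulVec b) := by
    have h := congrArg (skew q).mulVec e₁
    rw [Matrix.mulVec_add, qq, Matrix.mulVec_zero] at h
    rw [← sub_eq_zero, ← neg_eq_zero, ← h]
    module
  have ha : (k / 2) • a = (skew q).mulVec ((skewDual r).mulVec b) := by
    have h := congrArg (skew q).mulVec e₂
    rw [Matrix.mulVec_add, qq, Matrix.mulVec_zero] at h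
    rw [← sub_eq_zero, ← neg_eq_zero, ← h]
    module
  -- The third equation reads r̃ q p̃ b = p̃ q r̃ b; orthogonality of q to p and r moves q̃ to the
  -- front of both sides.
  have hdiff : (skewDual q).mulVec ((skew r).mulVec ((skewDual p).mulVec b)) =
      (skewDual q).mulVec ((skew p).mulVec ((skewDual r).mulVec b)) := by
    have h := congrArg ((k / 2) • ·) e₃
    simp only [← Matrix.mulVec_smul, ha, hc] at h
    have h1 := act' q r ((skewDual p).mulVec b)
    have h2 := act' p q ((skewDual r).mulVec b)
    rw [hqr, neg_zero, zero_smul] at h1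
    rw [hpq, neg_zero, zero_smul] at h2
    rw [eq_neg_of_add_eq_zero_left h1, eq_neg_of_add_eq_zero_right h2, h]
  have hk2 : -k / 2 ≠ 0 := div_ne_zero (neg_ne_zero.2 hq) two_ne_zero
  have hrp : (skew r).mulVec ((skewDual p).mulVec b) = (skew p).mulVec ((skewDual r).mulVec b) := by
    have h := congrArg (skew q).mulVec hdiff
    rw [qq, qq] at h
    exact smul_right_injective _ hk2 h
  -- The two equal vectors r p̃ b and p r̃ b add up to -⟨p,r⟩ b = 2k b.
  have hpb : (skew p).mulVec ((skewDual r).mulVec b) = k • b := by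
    have h := act p r b
    rw [hrp, ← two_smul ℂ, hpr] at h
    rw [← inv_smul_smul₀ (two_ne_zero' ℂ) ((skew p).mulVec _), h, smul_smul]
    congr 1; ring
  -- As p is null, p̃ p = 0; applied to p r̃ b = k b this kills p̃ b, and then k b = r p̃ b = 0.
  have hzero : (skewDual p).mulVec b = 0 := by
    have h := act' p p ((skewDual r).mulVec b)
    rw [hpb, hpp, neg_zero, zero_smul, ← two_smul ℂ, Matrix.mulVec_smul] at h
    simpa [hq] using h
  have hb : b = 0 := by
    rw [hzero, Matrix.mulVec_zero, hpb] at hrp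
    simpa [hq] using hrp.symm
  subst hb
  simp only [Matrix.mulVec_zero] at ha hc
  exact ⟨by simpa [hq] using ha, rfl, by simpa [hq] using hc⟩

/-- The components of a `2`-covector. -/
def comp2 (B : Cov 2) : Fin 6 → ℂ :=
  ![B ![stdB 0, stdB 1], B ![stdB 0, stdB 2], B ![stdB 0, stdB 3], B ![stdB 1, stdB 2],
    B ![stdB 1, stdB 3], B ![stdB 2, stdB 3]]

theorem pfaff_comp2 (A B : Cov 2) : pfaff (comp2 A) (comp2 B) = pair A B := by
  simp only [pair, topCoeff_eq, wedgeCov_two_two, pfaff, comp2, Matrix.cons_val]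

/-- Translates wedging with a two-form into matrix language: α ↦ α ∧ B is, up to the listed signs,
the Hodge-dual matrix of B acting on the components of α. -/
theorem skewDual_mulVec_comp2 (α : Cov 1) (B : Cov 2) :
    (skewDual (comp2 B)).mulVec (fun i => α ![stdB i]) =
      ![wedgeCov (n := 3) rfl α B ![stdB 1, stdB 2, stdB 3],
        -wedgeCov (n := 3) rfl α B ![stdB 0, stdB 2, stdB 3],
        wedgeCov (n := 3) rfl α B ![stdB 0, stdB 1, stdB 3],
        -wedgeCov (n := 3) rfl α B ![stdB 0, stdB 1, stdB 2]] := by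
  ext i
  fin_cases i <;>
    simp [skewDual, skew, comp2, Matrix.mulVec, dotProduct, Fin.sum_univ_four,
      wedgeCov_one_two] <;> ring

theorem cov_one_eq_zero {α : Cov 1} (h : (fun i => α ![stdB i]) = 0) : α = 0 := by
  ext v
  rw [fin_one_eta v]
  have e : v 0 = ∑ i, (v 0) i • stdB i := by
    ext j
    simp [stdB, Finset.sum_apply, Pi.single_apply]
  have hl (w : E4) : α ![w] =
      (ContinuousAlternatingMap.ofSubsingleton ℝ E4 ℂ (0 : Fin 1)).symm α w := by
    rw [ContinuousAlternatingMap.ofSubsingleton_symm_apply_apply]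
    congr 1; ext i : 1; fin_cases i; rfl
  rw [hl, e, map_sum]
  refine Finset.sum_eq_zero fun i _ => ?_
  rw [map_smul, ← hl, congrFun h i, Pi.zero_apply, smul_zero]

theorem torsion_injective {P Q R : Cov 2} {a b c : Cov 1}
    (hpp : pair P P = 0) (hpq : pair P Q = 0) (hqr : pair Q R = 0)
    (hpr : pair P R = -2 * pair Q Q) (hq : pair Q Q ≠ 0)
    (e₁ : wedgeCov (n := 3) rfl b P + wedgeCov (n := 3) rfl c Q = 0)
    (e₂ : wedgeCov (n := 3) rfl a Q + wedgeCov (n := 3) rfl b R = 0)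
    (e₃ : wedgeCov (n := 3) rfl c R - wedgeCov (n := 3) rfl a P = 0) :
    a = 0 ∧ b = 0 ∧ c = 0 := by
  simp only [← pfaff_comp2] at hpp hpq hqr hpr hq
  have f₁ (v : Fin 3 → E4) := congrArg (fun μ : Cov 3 => μ v) e₁
  have f₂ (v : Fin 3 → E4) := congrArg (fun μ : Cov 3 => μ v) e₂
  have f₃ (v : Fin 3 → E4) := congrArg (fun μ : Cov 3 => μ v) e₃
  simp only [ContinuousAlternatingMap.add_apply, ContinuousAlternatingMap.sub_apply,
    ContinuousAlternatingMap.coe_zero, Pi.zero_apply] at f₁ f₂ f₃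
  obtain ⟨ha, hb, hc⟩ := eq_zero_of_skewDual_mulVec (a := fun i => a ![stdB i])
    (b := fun i => b ![stdB i]) (c := fun i => c ![stdB i]) hpp hpq hqr hpr hq
    (by simp only [skewDual_mulVec_comp2, eq_neg_of_add_eq_zero_left (f₁ _)]
        ext i; fin_cases i <;> simp)
    (by simp only [skewDual_mulVec_comp2, eq_neg_of_add_eq_zero_left (f₂ _)]
        ext i; fin_cases i <;> simp)
    (by simp only [skewDual_mulVec_comp2, sub_eq_zero.1 (f₃ _)])
  exact ⟨cov_one_eq_zero ha, cov_one_eq_zero hb, cov_one_eq_zero hc⟩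

/-! ### Uniform estimates -/

/-- The function (x, v) ↦ ‖L x v‖ is continuous and positive on the compact K × unit sphere, so it
has a positive minimum; C is its inverse. This makes pointwise injectivity uniform up to the
boundary. -/
theorem exists_norm_le_of_injective {X V W : Type*} [TopologicalSpace X] [NormedAddCommGroup V]
    [NormedSpace ℝ V] [FiniteDimensional ℝ V] [NormedAddCommGroup W] [NormedSpace ℝ W]
    {K : Set X} (hK : IsCompact K) {L : X → V →L[ℝ] W} (hL : ContinuousOn L K)
    (hinj : ∀ x ∈ K, ∀ v, L x v = 0 → v = 0) :
    ∃ C, 0 ≤ C ∧ ∀ x ∈ K, ∀ v, ‖v‖ ≤ C * ‖L x v‖ := by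
  have hT : IsCompact (K ×ˢ Metric.sphere (0 : V) 1) := hK.prod (isCompact_sphere 0 1)
  have hf : ContinuousOn (fun z : X × V => ‖L z.1 z.2‖) (K ×ˢ Metric.sphere (0 : V) 1) :=
    ((hL.comp continuousOn_fst fun z hz => hz.1).clm_apply continuousOn_snd).norm
  rcases (K ×ˢ Metric.sphere (0 : V) 1).eq_empty_or_nonempty with he | hne
  · refine ⟨0, le_rfl, fun x hx v => ?_⟩
    by_contra! hv
    rw [zero_mul] at hv
    refine eq_empty_iff_forall_notMem.1 he (x, ‖v‖⁻¹ • v) ⟨hx, ?_⟩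
    simp [norm_smul, hv.ne']
  · obtain ⟨z, hz, hmin⟩ := hT.exists_isMinOn hne hf
    have hm : 0 < ‖L z.1 z.2‖ := by
      refine norm_pos_iff.2 fun h0 => ?_
      have := hinj z.1 hz.1 z.2 h0
      have h1 : ‖z.2‖ = 1 := by simpa using hz.2
      rw [this, norm_zero] at h1
      exact zero_ne_one h1
    refine ⟨‖L z.1 z.2‖⁻¹, inv_nonneg.2 hm.le, fun x hx v => ?_⟩
    rcases eq_or_ne v 0 with rfl | hv
    · simp
    have hv' : 0 < ‖v‖ := norm_pos_iff.2 hv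
    have h : ‖L z.1 z.2‖ ≤ ‖L x (‖v‖⁻¹ • v)‖ :=
      hmin (show (x, ‖v‖⁻¹ • v) ∈ _ from ⟨hx, by simp [norm_smul, hv]⟩)
    rw [map_smul, norm_smul, norm_inv, norm_norm] at h
    rw [inv_mul_eq_div, le_div_iff₀ hm]
    calc ‖v‖ * ‖L z.1 z.2‖ ≤ ‖v‖ * (‖v‖⁻¹ * ‖L x v‖) := by gcongr
      _ = ‖L x v‖ := by field_simp

/-- Near each point of K some continuous family of derivatives within s is bounded, and at interior
points it agrees with `fderiv`; compactness patches the local bounds. The bound thus persists up to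
boundary points, where `fderiv` itself may carry no information. -/
theorem exists_norm_fderiv_le {V W : Type*} [NormedAddCommGroup V] [NormedSpace ℝ V]
    [NormedAddCommGroup W] [NormedSpace ℝ W] {f : V → W} {s K : Set V} (hf : ContDiffOn ℝ 1 f s)
    (hK : IsCompact K) (hKs : K ⊆ s) : ∃ C, ∀ x ∈ K ∩ interior s, ‖fderiv ℝ f x‖ ≤ C := by
  refine hK.induction_on (p := fun t => ∃ C, ∀ x ∈ t ∩ interior s, ‖fderiv ℝ f x‖ ≤ C)
    ⟨0, by simp⟩ ?_ ?_ ?_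
  · rintro t t' htt' ⟨C, hC⟩
    exact ⟨C, fun x hx => hC x ⟨htt' hx.1, hx.2⟩⟩
  · rintro t t' ⟨C, hC⟩ ⟨C', hC'⟩
    refine ⟨max C C', fun x hx => ?_⟩
    rcases hx.1 with h | h
    · exact (hC x ⟨h, hx.2⟩).trans (le_max_left _ _)
    · exact (hC' x ⟨h, hx.2⟩).trans (le_max_right _ _)
  · intro x hx
    have hxs := hKs hx
    have h1 : ContDiffWithinAt ℝ (0 + 1) f s x := by simpa using hf x hxs
    obtain ⟨u, hu, -, -, f', hf', hcont⟩ :=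
      (contDiffWithinAt_succ_iff_hasFDerivWithinAt' (by simp)).1 h1
    rw [insert_eq_of_mem hxs] at hu
    have hb : ∀ᶠ y in 𝓝[s] x, ‖f' y‖ < ‖f' x‖ + 1 :=
      hcont.continuousWithinAt.norm.eventually_lt_const (lt_add_one _)
    refine ⟨{y | y ∈ u ∧ ‖f' y‖ < ‖f' x‖ + 1}, nhdsWithin_mono x hKs (inter_mem hu hb),
      ‖f' x‖ + 1, fun y hy => ?_⟩
    rw [((hf' y hy.1.1).hasFDerivAt (mem_interior_iff_mem_nhds.1 hy.2)).fderiv]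
    exact hy.1.2.le

theorem isCompact_Mbar : IsCompact Mbar := by
  have : Mbar = Metric.closedBall 0 2 ∩ {x | 1 ≤ ‖x‖} := by
    ext x; simp [Mbar, and_comm]
  rw [this]
  exact (isCompact_closedBall 0 2).inter_right (isClosed_le continuous_const continuous_norm)

theorem M_subset_Mbar : M ⊆ Mbar := fun _ hx => ⟨hx.1.le, hx.2.le⟩

theorem Mbar_subset_closure : Mbar ⊆ closure M := by
  intro x hx
  have hpos : 0 < ‖x‖ := one_pos.trans_le hx.1
  -- Move x radially towards the middle radius 3/2.
  have ht : Tendsto (fun t : ℝ => (((1 - t) * ‖x‖ + t * (3 / 2)) / ‖x‖) • x) (𝓝[>] 0) (𝓝 x) := by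
    have : Tendsto (fun t : ℝ => (((1 - t) * ‖x‖ + t * (3 / 2)) / ‖x‖) • x) (𝓝 0)
        (𝓝 ((((1 - 0) * ‖x‖ + 0 * (3 / 2)) / ‖x‖) • x)) := by
      apply Continuous.tendsto
      fun_prop
    rw [sub_zero, one_mul, zero_mul, add_zero, div_self hpos.ne', one_smul] at this
    exact this.mono_left nhdsWithin_le_nhds
  refine mem_closure_of_tendsto ht ?_
  filter_upwards [Ioo_mem_nhdsGT (zero_lt_one' ℝ)] with t ht
  obtain ⟨h1, h2⟩ := hx
  have hn : ‖(((1 - t) * ‖x‖ + t * (3 / 2)) / ‖x‖) • x‖ = (1 - t) * ‖x‖ + t * (3 / 2) := by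
    rw [norm_smul, Real.norm_of_nonneg, div_mul_cancel₀ _ hpos.ne']
    have := ht.1; have := ht.2
    apply div_nonneg _ hpos.le
    nlinarith
  have := ht.1; have := ht.2
  constructor <;> rw [hn] <;> nlinarith

/-- The torsion map of `(Σ^{00}, Σ^{01}, Σ^{11}) = (P, Q, R)` on `(γ_{00}, γ_{01}, γ_{11})`. -/
def torsionL (P Q R : Cov 2) : (Cov 1 × Cov 1 × Cov 1) →L[ℝ] (Cov 3 × Cov 3 × Cov 3) :=
  let a := ContinuousLinearMap.fst ℝ (Cov 1) (Cov 1 × Cov 1)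
  let b := (ContinuousLinearMap.fst ℝ (Cov 1) (Cov 1)).comp
    (ContinuousLinearMap.snd ℝ (Cov 1) (Cov 1 × Cov 1))
  let c := (ContinuousLinearMap.snd ℝ (Cov 1) (Cov 1)).comp
    (ContinuousLinearMap.snd ℝ (Cov 1) (Cov 1 × Cov 1))
  let w := (wedgeL (n := 3) (p := 1) (q := 2) rfl).flip
  ((w P).comp b + (w Q).comp c).prod
    (((w Q).comp a + (w R).comp b).prod ((w R).comp c - (w P).comp a))

theorem torsionL_apply (P Q R : Cov 2) (a b c : Cov 1) :
    torsionL P Q R (a, b, c) =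
      (wedgeCov (n := 3) rfl b P + wedgeCov (n := 3) rfl c Q,
        wedgeCov (n := 3) rfl a Q + wedgeCov (n := 3) rfl b R,
        wedgeCov (n := 3) rfl c R - wedgeCov (n := 3) rfl a P) := rfl

theorem continuousOn_torsionL {s : Set E4} {P Q R : E4 → Cov 2} (hP : ContinuousOn P s)
    (hQ : ContinuousOn Q s) (hR : ContinuousOn R s) :
    ContinuousOn (fun x => torsionL (P x) (Q x) (R x)) s := by
  have hw {T : E4 → Cov 2} (hT : ContinuousOn T s) :=
    ((wedgeL (n := 3) (p := 1) (q := 2) rfl).flip).continuous.comp_continuousOn hT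
  have hprod {U : Type} [NormedAddCommGroup U] [NormedSpace ℝ U] {V : Type}
      [NormedAddCommGroup V] [NormedSpace ℝ V]
      {f : E4 → (Cov 1 × Cov 1 × Cov 1) →L[ℝ] U} {g : E4 → (Cov 1 × Cov 1 × Cov 1) →L[ℝ] V}
      (hf : ContinuousOn f s) (hg : ContinuousOn g s) :
      ContinuousOn (fun x => (f x).prod (g x)) s :=
    (ContinuousLinearMap.prodₗᵢ (𝕜 := ℝ) (E := Cov 1 × Cov 1 × Cov 1) (F := U) (G := V)
      ℝ).continuous.comp_continuousOn (hf.prodMk hg)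
  exact hprod (((hw hP).clm_comp continuousOn_const).add ((hw hQ).clm_comp continuousOn_const))
    (hprod (((hw hQ).clm_comp continuousOn_const).add ((hw hR).clm_comp continuousOn_const))
      (((hw hR).clm_comp continuousOn_const).sub ((hw hP).clm_comp continuousOn_const)))

/-! ### Decay of the connection perturbation at the conformal boundary -/

theorem exists_norm_wedgeCov_le {p q n : ℕ} (h : p + q = n) :
    ∃ W, 0 ≤ W ∧ ∀ (α : Cov p) (β : Cov q), ‖wedgeCov h α β‖ ≤ W * ‖α‖ * ‖β‖ := by
  obtain ⟨W, hW, h⟩ := (wedgeL h).isBoundedBilinearMap.bound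
  exact ⟨W, hW.le, h⟩

theorem exists_norm_actUpper_le (p : ℕ) :
    ∃ W, 0 ≤ W ∧ ∀ (Γ : SForm 1) (X : SForm p) (x : E4) (a b : ℝ), 0 ≤ a →
      (∀ A B, ‖Γ A B x‖ ≤ a) → (∀ A B, ‖X A B x‖ ≤ b) →
      ∀ A B, ‖actUpper Γ X A B x‖ ≤ W * a * b := by
  obtain ⟨W, hW, hle⟩ := exists_norm_wedgeCov_le (Nat.add_comm 1 p)
  refine ⟨4 * W, by positivity, fun Γ X x a b ha hΓ hX A B => ?_⟩
  have hw (A B C D) : ‖wedgeCov (Nat.add_comm 1 p) (raiseFirst Γ A B x) (X C D x)‖ ≤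
      W * a * b := by
    refine (hle _ _).trans ?_
    have hr : ‖raiseFirst Γ A B x‖ ≤ a := by
      revert A
      simp only [Fin.forall_fin_two, raiseFirst_zero, raiseFirst_one, Pi.neg_apply, norm_neg]
      exact ⟨hΓ 1 B, hΓ 0 B⟩
    gcongr
    exact hX C D
  simp only [actUpper, Fin.sum_univ_two]
  refine (norm_add_le_of_le (norm_add_le_of_le (hw A 0 B 0) (hw B 0 A 0))
    (norm_add_le_of_le (hw A 1 B 1) (hw B 1 A 1))).trans (le_of_eq (by ring))

theorem actUpper_smul_right {p : ℕ} (Γ : SForm 1) {X Y : SForm p} {x : E4} {c : ℝ}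
    (h : ∀ A B, Y A B x = c • X A B x) (A B : Fin 2) :
    actUpper Γ Y A B x = c • actUpper Γ X A B x := by
  have hw (α : Cov 1) (β : Cov p) : wedgeCov (Nat.add_comm 1 p) α (c • β) =
      c • wedgeCov (Nat.add_comm 1 p) α β := (wedgeL (Nat.add_comm 1 p) α).map_smul c β
  simp only [actUpper, wedge, h, hw, smul_add, Finset.smul_sum]

section
variable {Λ : ℝ} {S S' : SForm 2} {Γ : SForm 1} {Ω : E4 → ℝ} {h : Perturbation}

/-- The rescaled self-dual two-forms satisfy the algebraic constraints up to the boundary. -/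
theorem rescaled_constraints (hbg : IsSelfDualBackground Λ S Γ)
    (hS' : ∀ A B, ContDiffOn ℝ ∞ (S' A B) Mbar)
    (hSS' : ∀ A B, ∀ x ∈ M, S' A B x = (Ω x ^ 2) • S A B x) {x : E4} (hx : x ∈ Mbar) :
    S' 1 0 x = S' 0 1 x ∧ ∀ I, symWedge S' S' I x = 0 := by
  constructor
  · refine EqOn.of_subset_closure (fun y hy => ?_) (hS' 1 0).continuousOn (hS' 0 1).continuousOn
      M_subset_Mbar Mbar_subset_closure hx
    rw [hSS' 1 0 y hy, hSS' 0 1 y hy, hbg.symm_S 1 0]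
  · intro I
    have hc : ContinuousOn (symWedge S' S' I) Mbar :=
      continuousOn_finsetSum _ fun π _ => (contDiffOn_wedge rfl (hS' _ _) (hS' _ _)).continuousOn
    refine EqOn.of_subset_closure (g := fun _ => 0) (fun y hy => ?_) hc continuousOn_const
      M_subset_Mbar Mbar_subset_closure hx
    have hw (α β : Cov 2) (c : ℝ) : wedgeCov (n := 4) rfl (c • α) (c • β) =
        (c * c) • wedgeCov (n := 4) rfl α β := by
      have h1 := (wedgeL (n := 4) rfl (c • α)).map_smul c β
      have h2 := (wedgeL (n := 4) (p := 2) (q := 2) rfl).map_smul₂ c α β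
      rw [mul_smul]
      exact h1.trans (congrArg (c • ·) h2)
    have h0 := hbg.simplicity I y hy
    simp only [symWedge, wedge] at h0 ⊢
    simp only [hSS' _ _ y hy]
    refine (Finset.sum_congr rfl fun π _ => hw _ _ _).trans ?_
    rw [← Finset.smul_sum]
    erw [h0, smul_zero]

/-- Nondegeneracy of Ω²Σ₀ up to the boundary makes the torsion map injective at every point of the
compact shell, so it can be inverted with one constant. This one bound serves both the background
connection and its perturbation. -/
theorem exists_norm_le_of_actUpper (hbg : IsSelfDualBackground Λ S Γ)
    (hS' : ∀ A B, ContDiffOn ℝ ∞ (S' A B) Mbar)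
    (hSS' : ∀ A B, ∀ x ∈ M, S' A B x = (Ω x ^ 2) • S A B x) (hvol : ∀ x ∈ Mbar, volForm S' x ≠ 0) :
    ∃ C, 0 ≤ C ∧ ∀ x ∈ M, ∀ γ : SForm 1, γ 1 0 = γ 0 1 → ∀ b,
      (∀ A B, ‖actUpper γ S' A B x‖ ≤ b) → ∀ A B, ‖γ A B x‖ ≤ C * b := by
  obtain ⟨C, hC0, hC⟩ := exists_norm_le_of_injective isCompact_Mbar
    (continuousOn_torsionL (hS' 0 0).continuousOn (hS' 0 1).continuousOn (hS' 1 1).continuousOn)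
    (by
      rintro x hx ⟨a, b, c⟩ h0
      obtain ⟨hsym, hsimp⟩ := rescaled_constraints hbg hS' hSS' hx
      obtain ⟨k0, k1, k2, k3, k4⟩ := pair_of_symWedge_eq_zero hsym hsym hsimp
      rw [pair_comm (S' 0 1 x) (S' 0 0 x), ← two_mul] at k1
      rw [pair_comm (S' 1 1 x) (S' 0 0 x)] at k2
      rw [pair_comm (S' 1 1 x) (S' 0 1 x), ← two_mul] at k3
      have hpr : pair (S' 0 0 x) (S' 1 1 x) = -2 * pair (S' 0 1 x) (S' 0 1 x) := by
        linear_combination k2 / 2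
      have hq : pair (S' 0 1 x) (S' 0 1 x) ≠ 0 := by
        intro hq
        apply hvol x hx
        have ht : topCoeff (volForm S' x) = 0 := by
          rw [topCoeff_volForm S' hsym hsimp, hpr, hq]; simp
        refine ContinuousAlternatingMap.toAlternatingMap_injective ?_
        -- A 4-covector is determined by its value on the standard basis, because injective index
        -- families are permutations of it.
        refine Module.Basis.ext_alternating (EuclideanSpace.basisFun (Fin 4) ℝ).toBasis
          fun v hv => ?_
        obtain ⟨e, rfl⟩ : ∃ e : Equiv.Perm (Fin 4), v = e :=
          ⟨Equiv.ofBijective v (Finite.injective_iff_bijective.1 hv), rfl⟩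
        have hb : (fun i => (EuclideanSpace.basisFun (Fin 4) ℝ).toBasis (e i)) = stdB ∘ e := by
          ext i : 1; simp [stdB]
        rw [hb]
        refine ((volForm S' x).toAlternatingMap.map_perm stdB e).trans ?_
        have : (volForm S' x).toAlternatingMap stdB = 0 := ht
        rw [this, smul_zero]
        rfl
      rw [torsionL_apply, Prod.mk_eq_zero, Prod.mk_eq_zero] at h0
      obtain ⟨ha, hb, hc⟩ := torsion_injective k0 (by linear_combination k1 / 2)
        (by linear_combination k3 / 2) hpr hq h0.1 h0.2.1 h0.2.2
      rw [ha, hb, hc]; rfl)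
  refine ⟨C, hC0, fun x hx γ hγ b hb => ?_⟩
  have hsym := (rescaled_constraints hbg hS' hSS' (M_subset_Mbar hx)).1
  have key := hC x (M_subset_Mbar hx) (γ 0 0 x, γ 0 1 x, γ 1 1 x)
  obtain ⟨p1, p2, -, p4⟩ := actUpper_eq γ S' x
  simp only [hγ, wedge, hsym] at p1 p2 p4
  have hb0 : 0 ≤ b := (norm_nonneg _).trans (hb 0 0)
  have n1 : ‖wedgeCov (n := 3) rfl (γ 0 1 x) (S' 0 0 x) +
      wedgeCov (n := 3) rfl (γ 1 1 x) (S' 0 1 x)‖ ≤ b := by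
    have := hb 0 0
    rw [p1, two_smul] at this
    refine le_trans ?_ this
    rw [← two_smul ℝ, norm_smul, Real.norm_ofNat]
    linarith [norm_nonneg (wedgeCov (n := 3) rfl (γ 0 1 x) (S' 0 0 x) +
      wedgeCov (n := 3) rfl (γ 1 1 x) (S' 0 1 x))]
  have n2 : ‖wedgeCov (n := 3) rfl (γ 0 0 x) (S' 0 1 x) +
      wedgeCov (n := 3) rfl (γ 0 1 x) (S' 1 1 x)‖ ≤ b := by
    have := hb 1 1
    rw [p4, two_smul, norm_neg] at this
    refine le_trans ?_ this
    rw [← two_smul ℝ, norm_smul, Real.norm_ofNat]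
    linarith [norm_nonneg (wedgeCov (n := 3) rfl (γ 0 0 x) (S' 0 1 x) +
      wedgeCov (n := 3) rfl (γ 0 1 x) (S' 1 1 x))]
  have n3 : ‖wedgeCov (n := 3) rfl (γ 1 1 x) (S' 1 1 x) -
      wedgeCov (n := 3) rfl (γ 0 0 x) (S' 0 0 x)‖ ≤ b := by
    have := hb 0 1
    rw [p2] at this
    refine le_trans (le_of_eq (congrArg _ ?_)) this
    abel
  have hL : ‖torsionL (S' 0 0 x) (S' 0 1 x) (S' 1 1 x) (γ 0 0 x, γ 0 1 x, γ 1 1 x)‖ ≤ b := by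
    rw [torsionL_apply]
    exact norm_prod_le_iff.2 ⟨n1, norm_prod_le_iff.2 ⟨n2, n3⟩⟩
  have hfin := key.trans (mul_le_mul_of_nonneg_left hL hC0)
  obtain ⟨m1, m23⟩ := norm_prod_le_iff.1 hfin
  obtain ⟨m2, m3⟩ := norm_prod_le_iff.1 m23
  simp only [Fin.forall_fin_two, hγ]
  exact ⟨⟨m1, m2⟩, m2, m3⟩

end

theorem exists_uniform_bound {f : Fin 2 → Fin 2 → E4 → ℝ} {K : Set E4}
    (h : ∀ A B, ∃ C, ∀ x ∈ K, f A B x ≤ C) : ∃ C, 0 ≤ C ∧ ∀ A B, ∀ x ∈ K, f A B x ≤ C := by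
  choose C hC using h
  refine ⟨|C 0 0| + |C 0 1| + (|C 1 0| + |C 1 1|), by positivity, ?_⟩
  simp only [Fin.forall_fin_two]
  have h00 := abs_nonneg (C 0 0)
  have h01 := abs_nonneg (C 0 1)
  have h10 := abs_nonneg (C 1 0)
  have h11 := abs_nonneg (C 1 1)
  refine ⟨⟨fun x hx => ?_, fun x hx => ?_⟩, fun x hx => ?_, fun x hx => ?_⟩
  · linarith [hC 0 0 x hx, le_abs_self (C 0 0)]
  · linarith [hC 0 1 x hx, le_abs_self (C 0 1)]
  · linarith [hC 1 0 x hx, le_abs_self (C 1 0)]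
  · linarith [hC 1 1 x hx, le_abs_self (C 1 1)]

/-- The product rule for g = Ω² f gives Ω² df = dg - 2Ω dΩ ⊗ f, and Ω f = g/Ω. This division by Ω is
the source of the simple pole of Γ₀. -/
theorem norm_sq_smul_fderiv_le {W : Type*} [NormedAddCommGroup W] [NormedSpace ℝ W] {Ω : E4 → ℝ}
    {f g : E4 → W} {x : E4} (dΩ : DifferentiableAt ℝ Ω x) (df : DifferentiableAt ℝ f x)
    (hev : g =ᶠ[𝓝 x] fun y => (Ω y ^ 2) • f y) (hΩ : Ω x ≠ 0) :
    ‖(Ω x ^ 2) • fderiv ℝ f x‖ ≤ ‖fderiv ℝ g x‖ + 2 * ‖fderiv ℝ Ω x‖ * ‖g x‖ / |Ω x| := by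
  have hder : (Ω x ^ 2) • fderiv ℝ f x = fderiv ℝ g x -
      (((2 : ℝ) * Ω x) • fderiv ℝ Ω x).smulRight (f x) := by
    rw [hev.fderiv_eq, fderiv_fun_smul (dΩ.fun_pow 2) df, fderiv_fun_pow 2 dΩ]
    simp
  rw [hder]
  refine (norm_sub_le _ _).trans (add_le_add_right (le_of_eq ?_) _)
  have hpos := abs_pos.2 hΩ
  rw [ContinuousLinearMap.norm_smulRight_apply, norm_smul, norm_mul, Real.norm_ofNat,
    Real.norm_eq_abs, hev.self_of_nhds, norm_smul, norm_pow, Real.norm_eq_abs]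
  field_simp

theorem M_subset_interior_Mbar : M ⊆ interior Mbar :=
  isOpen_M.subset_interior_iff.2 M_subset_Mbar

section
variable {Λ : ℝ} {S : SForm 2} {Γ : SForm 1} {Ω : E4 → ℝ} {h : Perturbation}

/-- The background connection has at most a simple pole at the conformal boundary. -/
theorem exists_norm_connection_le (hbg : IsSelfDualBackground Λ S Γ)
    (hΩ : IsConformalCompactification Ω S) :
    ∃ C, 0 ≤ C ∧ ∀ x ∈ M, ∀ A B, ‖Γ A B x‖ ≤ C / |Ω x| := by
  obtain ⟨S', hS', hSS', hvol⟩ := hΩ.rescaled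
  obtain ⟨C, hC0, hC⟩ := exists_norm_le_of_actUpper hbg hS' hSS' hvol
  obtain ⟨c₁, hc₁, hdS'⟩ := exists_uniform_bound (f := fun A B x => ‖fderiv ℝ (S' A B) x‖)
    fun A B => exists_norm_fderiv_le ((hS' A B).of_le (by simp)) isCompact_Mbar subset_rfl
  obtain ⟨c₂, hdΩ⟩ := exists_norm_fderiv_le (hΩ.smooth.of_le (by simp)) isCompact_Mbar subset_rfl
  obtain ⟨c₃, hc₃, hbS'⟩ := exists_uniform_bound (f := fun A B x => ‖S' A B x‖)
    fun A B => isCompact_Mbar.exists_bound_of_continuousOn (hS' A B).continuousOn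
  obtain ⟨c₄, hbΩ⟩ := isCompact_Mbar.exists_bound_of_continuousOn hΩ.smooth.continuousOn
  -- The factor 2 + 1 bounds the alternation of the derivative of a 2-form; c₁|c₄| absorbs the
  -- regular term dS' into a multiple of 1/|Ω|.
  refine ⟨C * (((2 : ℕ) + 1) * (c₁ * |c₄| + 2 * |c₂| * c₃)), by positivity, fun x hx => ?_⟩
  have hΩx : 0 < |Ω x| := abs_pos.2 (hΩ.ne_zero x hx)
  have hxm := M_subset_Mbar hx
  have hxi : x ∈ Mbar ∩ interior Mbar := ⟨hxm, M_subset_interior_Mbar hx⟩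
  have h4 : |Ω x| ≤ |c₄| := (hbΩ x hxm).trans (le_abs_self _)
  rw [mul_div_assoc]
  refine hC x hx Γ (hbg.symm_Γ 1 0) _ fun A B => ?_
  rw [actUpper_smul_right Γ (fun A B => hSS' A B x hx)]
  have htor : actUpper Γ S A B x = -extDeriv (S A B) x :=
    eq_neg_of_add_eq_zero_right (hbg.torsion_free A B x hx)
  have dS : DifferentiableAt ℝ (S A B) x := differentiableAt_of_contDiffOn_M (hbg.smooth_S A B) hx
  have dΩ : DifferentiableAt ℝ Ω x :=
    (hΩ.smooth.contDiffAt (mem_interior_iff_mem_nhds.1 hxi.2)).differentiableAt (by simp)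
  have hev : S' A B =ᶠ[𝓝 x] fun y => (Ω y ^ 2) • S A B y := by
    filter_upwards [isOpen_M.mem_nhds hx] with y hy using hSS' A B y hy
  have hnorm : ‖(Ω x ^ 2) • fderiv ℝ (S A B) x‖ ≤ (c₁ * |c₄| + 2 * |c₂| * c₃) / |Ω x| := by
    refine (norm_sq_smul_fderiv_le dΩ dS hev (hΩ.ne_zero x hx)).trans ?_
    have h1 := hdS' A B x hxi
    have h2 := (hdΩ x hxi).trans (le_abs_self _)
    have h3 := hbS' A B x hxm
    rw [add_div]
    refine add_le_add ?_ (by gcongr)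
    rw [le_div_iff₀ hΩx]
    gcongr
  have hlin : (Ω x ^ 2) • extDeriv (S A B) x =
      ContinuousAlternatingMap.alternatizeUncurryFin ((Ω x ^ 2) • fderiv ℝ (S A B) x) :=
    (map_smul (ContinuousAlternatingMap.alternatizeUncurryFinCLM ℝ E4 ℂ (n := 2)) _ _).symm
  rw [htor, smul_neg, norm_neg, hlin, mul_div_assoc]
  exact (ContinuousAlternatingMap.norm_alternatizeUncurryFin_le _).trans
    (mul_le_mul_of_nonneg_left hnorm (by norm_num))

/-- The connection perturbation vanishes at a boundary component to which `σ` extends smoothly. -/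
theorem exists_norm_gamma_le (hbg : IsSelfDualBackground Λ S Γ)
    (hΩ : IsConformalCompactification Ω S) (hh : IsScatteringState Λ S Γ Ω h) {ρ : ℝ}
    (hρ : ρ = 1 ∨ ρ = 2) (hσ : ∀ A B, ExtendsSmoothly (h.σ A B) M (M ∪ scri ρ)) :
    ∃ C, 0 ≤ C ∧ ∀ x ∈ M, |‖x‖ - ρ| ≤ 1 / 2 → ∀ A B, ‖h.γ A B x‖ ≤ C * |Ω x| := by
  obtain ⟨S', hS', hSS', hvol⟩ := hΩ.rescaled
  obtain ⟨C, hC0, hC⟩ := exists_norm_le_of_actUpper hbg hS' hSS' hvol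
  obtain ⟨c, hc, hΓ⟩ := exists_norm_connection_le hbg hΩ
  choose g hg hgσ using hσ
  -- Half the width of the shell: K touches only the boundary component at ρ, where σ is known to
  -- extend.
  let K : Set E4 := Mbar ∩ {x | |‖x‖ - ρ| ≤ 1 / 2}
  have hK : IsCompact K :=
    isCompact_Mbar.inter_right (isClosed_le (by fun_prop) continuous_const)
  have hKM : K ⊆ M ∪ scri ρ := by
    rintro x ⟨⟨h1, h2⟩, h3⟩
    rw [mem_ofPred_eq, abs_le] at h3
    simp only [M, scri, mem_union, mem_ofPred_eq, mem_sphere_iff_norm, sub_zero]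
    rcases hρ with rfl | rfl
    · rcases h1.eq_or_lt with h | h
      · exact Or.inr h.symm
      · exact Or.inl ⟨h, by linarith⟩
    · rcases h2.eq_or_lt with h | h
      · exact Or.inr h
      · exact Or.inl ⟨by linarith, h⟩
  obtain ⟨c₁, hc₁, hdg⟩ := exists_uniform_bound (f := fun A B x => ‖fderiv ℝ (g A B) x‖)
    fun A B => exists_norm_fderiv_le ((hg A B).of_le (by simp)) hK hKM
  obtain ⟨c₂, hc₂, hbg'⟩ := exists_uniform_bound (f := fun A B x => ‖g A B x‖)
    fun A B => hK.exists_bound_of_continuousOn ((hg A B).continuousOn.mono hKM)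
  obtain ⟨c₄, hbΩ⟩ := isCompact_Mbar.exists_bound_of_continuousOn hΩ.smooth.continuousOn
  obtain ⟨W, hW, hact⟩ := exists_norm_actUpper_le 2
  refine ⟨C * (|c₄| * (((2 : ℕ) + 1) * c₁) + W * c * c₂), by positivity, fun x hx hxρ => ?_⟩
  have hΩx : 0 < |Ω x| := abs_pos.2 (hΩ.ne_zero x hx)
  have hxm := M_subset_Mbar hx
  have h4 : |Ω x| ≤ |c₄| := (hbΩ x hxm).trans (le_abs_self _)
  have hxK : x ∈ K := ⟨hxm, hxρ⟩
  have hxi : x ∈ K ∩ interior (M ∪ scri ρ) :=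
    ⟨hxK, (isOpen_M.subset_interior_iff.2 subset_union_left) hx⟩
  rw [mul_assoc]
  refine hC x hx h.γ (hh.symm_γ 1 0) _ fun A B => ?_
  have htor : actUpper h.γ S A B x = -(extDeriv (h.σ A B) x + actUpper Γ h.σ A B x) :=
    neg_eq_iff_eq_neg.1 (hh.lin_torsion A B x hx).symm
  have hev : h.σ A B =ᶠ[𝓝 x] g A B := by
    filter_upwards [isOpen_M.mem_nhds hx] with y hy using (hgσ A B hy).symm
  have hdσ : ‖extDeriv (h.σ A B) x‖ ≤ ((2 : ℕ) + 1) * c₁ := by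
    rw [extDeriv, hev.fderiv_eq]
    exact (ContinuousAlternatingMap.norm_alternatizeUncurryFin_le _).trans
      (mul_le_mul_of_nonneg_left (hdg A B x hxi) (by norm_num))
  have hΓσ := hact Γ h.σ x _ c₂ (by positivity) (hΓ x hx)
    (fun A B => by rw [← hgσ A B hx]; exact hbg' A B x hxK) A B
  rw [actUpper_smul_right h.γ (fun A B => hSS' A B x hx), htor, norm_smul, norm_neg, norm_pow,
    Real.norm_eq_abs]
  -- Of the two powers of Ω, the pole of Γ₀ consumes one; the other is the claimed decay.
  calc |Ω x| ^ 2 * ‖extDeriv (h.σ A B) x + actUpper Γ h.σ A B x‖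
      ≤ |Ω x| ^ 2 * (((2 : ℕ) + 1) * c₁ + W * (c / |Ω x|) * c₂) := by
        gcongr
        exact norm_add_le_of_le hdσ hΓσ
    _ = (|Ω x| * (((2 : ℕ) + 1) * c₁) + W * c * c₂) * |Ω x| := by field_simp
    _ ≤ (|c₄| * (((2 : ℕ) + 1) * c₁) + W * c * c₂) * |Ω x| := by gcongr

end

/-! ### The fundamental theorem of calculus in weak form -/

theorem integrable_smul_of_tsupport_subset {E : Type*} [NormedAddCommGroup E] [MeasurableSpace E]
    [BorelSpace E] {μ : Measure E} [IsFiniteMeasureOnCompacts μ] {U : Set E} (hU : IsOpen U)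
    {φ : E → ℝ} (hφ : Continuous φ) (hc : HasCompactSupport φ) (hs : tsupport φ ⊆ U) {f : E → ℂ}
    (hf : ContinuousOn f U) : Integrable (fun x => φ x • f x) μ := by
  have hsub : tsupport (fun x => φ x • f x) ⊆ tsupport φ := tsupport_smul_subset_left φ f
  refine Continuous.integrable_of_hasCompactSupport (continuous_of_tsupport fun x hx => ?_)
    (hc.mono' (subset_closure.trans hsub))
  have hxU := hs (hsub hx)
  exact hφ.continuousAt.smul (hf.continuousAt (hU.mem_nhds hxU))

/-- The primitive based at a vanishes to the left of the support of ρ, and to its right equals the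
total integral, which is zero. -/
theorem exists_primitive_of_integral_eq_zero {a b : ℝ} (hab : a < b) {ρ : ℝ → ℝ}
    (hρ : ContDiff ℝ ∞ ρ) (hc : HasCompactSupport ρ) (hs : tsupport ρ ⊆ Ioo a b)
    (h0 : ∫ t, ρ t = 0) :
    ∃ φ : ℝ → ℝ, ContDiff ℝ ∞ φ ∧ HasCompactSupport φ ∧ tsupport φ ⊆ Ioo a b ∧
      ∀ r, HasDerivAt φ (ρ r) r := by
  have hcont : Continuous ρ := hρ.continuous
  have hder (r : ℝ) : HasDerivAt (fun r => ∫ t in a..r, ρ t) (ρ r) r :=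
    intervalIntegral.integral_hasDerivAt_right (hcont.intervalIntegrable _ _)
      (hcont.stronglyMeasurableAtFilter _ _) hcont.continuousAt
  -- The midpoint is added only to make the compact set nonempty, so that it has a least and a
  -- greatest element even when ρ = 0.
  have hK : IsCompact (insert ((a + b) / 2) (tsupport ρ)) := IsCompact.insert hc _
  have hKs : insert ((a + b) / 2) (tsupport ρ) ⊆ Ioo a b :=
    insert_subset ⟨by linarith, by linarith⟩ hs
  obtain ⟨l, hl, hlm⟩ := hK.exists_isLeast (insert_nonempty _ _)
  obtain ⟨m, hm, hmm⟩ := hK.exists_isGreatest (insert_nonempty _ _)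
  have hzero : ∀ t, t ∉ Icc l m → ρ t = 0 := fun t ht => by
    refine image_eq_zero_of_notMem_tsupport fun h => ht ⟨hlm (Or.inr h), hmm (Or.inr h)⟩
  have hl' := hKs hl
  have hm' := hKs hm
  have hsupp : Function.support (fun r => ∫ t in a..r, ρ t) ⊆ Icc l m := by
    intro r hr
    by_contra hnot
    apply hr
    rcases lt_or_ge r l with h | h
    · refine intervalIntegral.integral_zero_ae (.of_forall fun t ht => hzero t fun h' => ?_)
      have : t ≤ max a r := ht.2
      exact absurd h'.1 (not_le.2 (this.trans_lt (max_lt hl'.1 h)))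
    · have hmr : m < r := by
        by_contra! h'
        exact hnot ⟨h, h'⟩
      change ∫ t in a..r, ρ t = 0
      rw [intervalIntegral.integral_eq_integral_of_support_subset, h0]
      intro t ht
      have : t ∈ Icc l m := by
        by_contra h'
        exact ht (hzero t h')
      exact ⟨hl'.1.trans_le this.1, this.2.trans hmr.le⟩
  have hts : tsupport (fun r => ∫ t in a..r, ρ t) ⊆ Icc l m :=
    closure_minimal hsupp isClosed_Icc
  refine ⟨_, ?_, ?_, hts.trans fun t ht => ⟨hl'.1.trans_le ht.1, ht.2.trans_lt hm'.2⟩, hder⟩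
  · rw [contDiff_infty_iff_deriv]
    refine ⟨fun r => (hder r).differentiableAt, ?_⟩
    rwa [show deriv (fun r => ∫ t in a..r, ρ t) = ρ from funext fun r => (hder r).deriv]
  · exact isCompact_Icc.of_isClosed_subset (isClosed_tsupport _) hts

/-- A continuous function with continuous weak derivative satisfies the fundamental theorem of
calculus. -/
theorem sub_eq_integral_of_weak_deriv {a b : ℝ} {W D : ℝ → ℂ} (hW : ContinuousOn W (Ioo a b))
    (hD : ContinuousOn D (Ioo a b))
    (hweak : ∀ φ : ℝ → ℝ, ContDiff ℝ ∞ φ → HasCompactSupport φ → tsupport φ ⊆ Ioo a b →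
      ∫ r, φ r • D r = -∫ r, deriv φ r • W r) {s t : ℝ} (hs : s ∈ Ioo a b) (ht : t ∈ Ioo a b) :
    W t - W s = ∫ r in s..t, D r := by
  have hab : a < b := hs.1.trans hs.2
  have hint {x y : ℝ} (hx : x ∈ Ioo a b) (hy : y ∈ Ioo a b) :
      IntervalIntegrable D volume x y :=
    (hD.mono ((convex_Ioo a b).ordConnected.uIcc_subset hx hy)).intervalIntegrable
  set P : ℝ → ℂ := fun r => ∫ x in s..r, D x with hP
  have hPder {r : ℝ} (hr : r ∈ Ioo a b) : HasDerivAt P (D r) r :=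
    intervalIntegral.integral_hasDerivAt_right (hint hs hr)
      (hD.stronglyMeasurableAtFilter isOpen_Ioo r hr) (hD.continuousAt (isOpen_Ioo.mem_nhds hr))
  have hPc : ContinuousOn P (Ioo a b) := fun r hr => (hPder hr).continuousAt.continuousWithinAt
  have hGc : ContinuousOn (fun r => W r - P r) (Ioo a b) := hW.sub hPc
  have hG {φ : ℝ → ℝ} (h1 : ContDiff ℝ ∞ φ) (h2 : HasCompactSupport φ)
      (h3 : tsupport φ ⊆ Ioo a b) : ∫ r, deriv φ r • (W r - P r) = 0 := by
    have hφ' : Continuous (deriv φ) := h1.continuous_deriv (by simp)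
    have hc' : HasCompactSupport (deriv φ) := h2.deriv
    have hs' : tsupport (deriv φ) ⊆ Ioo a b :=
      (closure_minimal (support_deriv_subset) (isClosed_tsupport φ)).trans h3
    have i1 := integrable_smul_of_tsupport_subset (μ := volume) isOpen_Ioo hφ' hc' hs' hW
    have i2 := integrable_smul_of_tsupport_subset (μ := volume) isOpen_Ioo hφ' hc' hs' hPc
    have i3 := integrable_smul_of_tsupport_subset (μ := volume) isOpen_Ioo h1.continuous h2 h3 hPc
    have i4 := integrable_smul_of_tsupport_subset (μ := volume) isOpen_Ioo h1.continuous h2 h3 hD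
    have hPD : (fun r => φ r • fderiv ℝ P r 1) = fun r => φ r • D r := by
      ext1 r
      by_cases hr : r ∈ tsupport φ
      · rw [fderiv_apply_one_eq_deriv, (hPder (h3 hr)).deriv]
      · rw [image_eq_zero_of_notMem_tsupport hr, zero_smul, zero_smul]
    have parts := integral_smul_fderiv_eq_neg_fderiv_smul_of_integrable (μ := volume) (𝕜 := ℝ)
      (f := φ) (g := P) (v := 1) (by simpa only [fderiv_apply_one_eq_deriv] using i2)
      (by rw [hPD]; exact i4) i3
      (fun r _ => (h1.differentiable (by simp)).differentiableAt)
      (fun r hr => (hPder (h3 hr)).differentiableAt)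
    simp only [fderiv_apply_one_eq_deriv] at parts
    have hPD' : (fun r => φ r • deriv P r) = fun r => φ r • D r := by
      simpa only [fderiv_apply_one_eq_deriv] using hPD
    rw [hPD', hweak φ h1 h2 h3, neg_inj] at parts
    simp only [smul_sub]
    rw [integral_sub i1 i2, parts, sub_self]
  -- W - P has zero weak derivative. As in the du Bois-Reymond lemma, it must equal c, its average
  -- against this normalised bump: for a test function g, the difference g - (∫ g)η has integral
  -- zero and hence a compactly supported primitive to test with.
  let η : ContDiffBump ((a + b) / 2) :=
    ⟨(b - a) / 8, (b - a) / 4, by linarith, by linarith⟩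
  have hη : ContDiff ℝ ∞ (η.normed volume) := η.contDiff_normed
  have hηc : HasCompactSupport (η.normed volume) := η.hasCompactSupport_normed
  have hηs : tsupport (η.normed volume) ⊆ Ioo a b := by
    rw [η.tsupport_normed_eq, Real.closedBall_eq_Icc]
    exact Icc_subset_Ioo (by simp only [η]; linarith) (by simp only [η]; linarith)
  set c : ℂ := ∫ r, η.normed volume r • (W r - P r) with hcdef
  have hae : ∀ᵐ r : ℝ, r ∈ Ioo a b → (W r - P r) - c = 0 := by
    refine isOpen_Ioo.ae_eq_zero_of_integral_contDiff_smul_eq_zero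
      ((hGc.sub continuousOn_const).locallyIntegrableOn measurableSet_Ioo) fun g h1 h2 h3 => ?_
    have hgi : Integrable g := h1.continuous.integrable_of_hasCompactSupport h2
    have hηi : Integrable (η.normed volume) := η.integrable_normed
    have hsub : tsupport (fun r => g r - (∫ x, g x) * η.normed volume r) ⊆
        tsupport g ∪ tsupport (η.normed volume) := by
      refine closure_minimal (fun r hr => ?_)
        ((isClosed_tsupport _).union (isClosed_tsupport _))
      by_contra hnot
      rw [mem_union, not_or] at hnot
      apply hr
      simp only [image_eq_zero_of_notMem_tsupport hnot.1,
        image_eq_zero_of_notMem_tsupport hnot.2, mul_zero, sub_zero]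
    obtain ⟨φ, hφ1, hφ2, hφ3, hφ'⟩ := exists_primitive_of_integral_eq_zero hab
      (ρ := fun r => g r - (∫ x, g x) * η.normed volume r)
      (h1.sub (contDiff_const.mul hη))
      ((h2.isCompact.union hηc.isCompact).of_isClosed_subset (isClosed_tsupport _) hsub)
      (hsub.trans (union_subset h3 hηs))
      (by rw [integral_sub hgi (hηi.const_mul _), integral_const_mul, η.integral_normed, mul_one,
        sub_self])
    have hz := hG hφ1 hφ2 hφ3
    have j1 := integrable_smul_of_tsupport_subset (μ := volume) isOpen_Ioo h1.continuous h2 h3 hGc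
    have j2 := integrable_smul_of_tsupport_subset (μ := volume) isOpen_Ioo hη.continuous hηc hηs hGc
    simp only [(hφ' _).deriv, sub_smul, mul_smul] at hz
    have j2' : Integrable (fun r => (∫ x, g x) • η.normed volume r • (W r - P r)) :=
      j2.smul (∫ x, g x)
    rw [integral_sub j1 j2', integral_smul, sub_eq_zero, ← hcdef] at hz
    simp only [smul_sub] at hz ⊢
    have j3 : Integrable (fun r => g r • c) := hgi.smul_const c
    simp only [smul_sub] at j1
    rw [integral_sub j1 j3, hz, integral_smul_const, sub_self]
  have heq : EqOn (fun r => W r - P r) (fun _ => c) (Ioo a b) := by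
    refine Measure.eqOn_open_of_ae_eq (μ := volume) ?_ isOpen_Ioo hGc continuousOn_const
    rw [EventuallyEq, ae_restrict_iff' measurableSet_Ioo]
    filter_upwards [hae] with r hr hr' using sub_eq_zero.1 (hr hr')
  have e1 := heq hs
  have e2 := heq ht
  have hPs : P s = 0 := intervalIntegral.integral_same
  simp only [hPs, sub_zero] at e1
  simp only [← e1] at e2
  rw [← e2]
  ring

/-! ### Polar coordinates -/

/-- The integral of a function over the sphere of radius `r`. -/
def sphereIntegral (F : E4 → ℂ) (r : ℝ) : ℂ :=
  ∫ u : Metric.sphere (0 : E4) 1, ((r ^ 3 : ℝ) : ℂ) * F (r • (u : E4))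
    ∂((volume : Measure E4).toSphere)

theorem integral_polar {F : E4 → ℂ} (hF : Integrable F) :
    IntegrableOn (sphereIntegral F) (Ioi 0) ∧ ∫ x, F x = ∫ r in Ioi (0 : ℝ), sphereIntegral F r := by
  have hmp := (volume : Measure E4).measurePreserving_homeomorphUnitSphereProd
  -- The radial density is r³, matching the factor built into `sphereIntegral`.
  have hdim : Module.finrank ℝ E4 - 1 = 3 := by simp
  rw [hdim] at hmp
  let g : Metric.sphere (0 : E4) 1 × Ioi (0 : ℝ) → ℂ := fun z => F ((z.2 : ℝ) • (z.1 : E4))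
  have hg (x : ({0}ᶜ : Set E4)) : g (homeomorphUnitSphereProd E4 x) = F x := by
    have hx : ‖(x : E4)‖ ≠ 0 := norm_ne_zero_iff.2 x.2
    simp [g, smul_smul, mul_inv_cancel₀ hx]
  have hemb := (homeomorphUnitSphereProd E4).measurableEmbedding
  have hgi : Integrable g ((volume : Measure E4).toSphere.prod (.volumeIoiPow 3)) := by
    rw [← hmp.integrable_comp_emb hemb]
    have : g ∘ homeomorphUnitSphereProd E4 = F ∘ Subtype.val := funext hg
    rw [this, ← integrableOn_iff_comap_subtypeVal (measurableSet_singleton _).compl]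
    exact hF.integrableOn
  have h1 : ∫ x, F x = ∫ z, g z ∂((volume : Measure E4).toSphere.prod (.volumeIoiPow 3)) := by
    rw [← hmp.integral_comp hemb]
    simp only [hg]
    rw [integral_subtype_comap (measurableSet_singleton _).compl F, restrict_compl_singleton]
  have hmeas : Measurable fun r : Ioi (0 : ℝ) => Real.toNNReal (r.1 ^ 3) :=
    (measurable_subtype_coe.pow_const _).real_toNNReal
  have hpt (r : Ioi (0 : ℝ)) : Real.toNNReal (r.1 ^ 3) • ∫ u, g (u, r) ∂(volume : Measure E4).toSphere =
      sphereIntegral F r := by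
    rw [sphereIntegral, integral_const_mul, NNReal.smul_def,
      Real.coe_toNNReal _ (pow_nonneg r.2.out.le _), Complex.real_smul]
  have h2 := hgi.integral_prod_right
  have h3 : ∫ r, (∫ u, g (u, r) ∂(volume : Measure E4).toSphere) ∂(.volumeIoiPow 3) =
      ∫ r in Ioi (0 : ℝ), sphereIntegral F r := by
    rw [Measure.volumeIoiPow]
    simp only [ENNReal.ofReal]
    rw [integral_withDensity_eq_integral_smul hmeas]
    simp only [hpt]
    exact integral_subtype_comap measurableSet_Ioi (sphereIntegral F)
  refine ⟨?_, ?_⟩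
  · rw [Measure.volumeIoiPow] at h2
    simp only [ENNReal.ofReal] at h2
    rw [integrable_withDensity_iff_integrable_smul hmeas] at h2
    simp only [hpt] at h2
    exact (integrableOn_iff_comap_subtypeVal measurableSet_Ioi).2 h2
  · rw [h1, integral_prod_symm _ hgi, h3]

theorem norm_smul_sphere {r : ℝ} (hr : 0 < r) (u : Metric.sphere (0 : E4) 1) :
    ‖r • (u : E4)‖ = r := by
  rw [norm_smul, norm_eq_of_mem_sphere, mul_one, Real.norm_of_nonneg hr.le]

theorem sphereIntegral_radial_smul {φ : ℝ → ℝ} {F : E4 → ℂ} {r : ℝ} (hr : 0 < r) :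
    sphereIntegral (fun x => φ ‖x‖ • F x) r = φ r • sphereIntegral F r := by
  simp only [sphereIntegral, norm_smul_sphere hr]
  rw [← integral_smul]
  congr 1
  ext1 u
  simp only [Complex.real_smul]
  ring

theorem smul_sphere_mem_M {r : ℝ} (hr : r ∈ Ioo (1 : ℝ) 2) (u : Metric.sphere (0 : E4) 1) :
    r • (u : E4) ∈ M := by
  have : ‖r • (u : E4)‖ = r := norm_smul_sphere (one_pos.trans hr.1) u
  exact ⟨hr.1.trans_eq this.symm, this.trans_lt hr.2⟩

theorem continuousOn_sphereIntegral {F : E4 → ℂ} (hF : ContinuousOn F M) :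
    ContinuousOn (sphereIntegral F) (Ioo 1 2) := by
  rw [continuousOn_iff_continuous_domRestrict]
  have := (isOpen_Ioo (a := (1 : ℝ)) (b := 2)).locallyCompactSpace
  have hc : Continuous (Function.uncurry fun (r : Ioo (1 : ℝ) 2) (u : Metric.sphere (0 : E4) 1) =>
      ((((r : ℝ) ^ 3 : ℝ)) : ℂ) * F ((r : ℝ) • (u : E4))) := by
    refine Continuous.mul (by fun_prop) ?_
    exact hF.comp_continuous (by fun_prop) fun z => smul_sphere_mem_M z.1.2 z.2
  have := continuous_parametric_integral_of_continuous
    (μ := (volume : Measure E4).toSphere) hc isCompact_univ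
  simp only [Measure.restrict_univ] at this
  exact this

/-! ### The divergence theorem on the shell -/

theorem radial_facts {φ : ℝ → ℝ} (h1 : ContDiff ℝ ∞ φ)
    (h3 : tsupport φ ⊆ Ioo 1 2) :
    HasCompactSupport (fun x : E4 => φ ‖x‖) ∧ tsupport (fun x : E4 => φ ‖x‖) ⊆ M ∧
    Differentiable ℝ (fun x : E4 => φ ‖x‖) ∧
    ∀ x v : E4, fderiv ℝ (fun x : E4 => φ ‖x‖) x v = deriv φ ‖x‖ * (inner ℝ x v / ‖x‖) := by
  have hsub : tsupport (fun x : E4 => φ ‖x‖) ⊆ (fun x : E4 => ‖x‖) ⁻¹' tsupport φ :=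
    closure_minimal (fun x hx => subset_closure hx)
      ((isClosed_tsupport φ).preimage continuous_norm)
  have hM : tsupport (fun x : E4 => φ ‖x‖) ⊆ M := fun x hx => h3 (hsub hx)
  have hd (x : E4) : HasFDerivAt (fun x : E4 => φ ‖x‖)
      ((deriv φ ‖x‖ / ‖x‖) • innerSL ℝ x) x := by
    -- The norm is not differentiable at the origin, but φ ‖x‖ vanishes near it, and the stated
    -- derivative is zero there.
    rcases eq_or_ne x 0 with rfl | hx
    · have h0 : (0 : E4) ∉ tsupport (fun x : E4 => φ ‖x‖) := fun h => by
        have := (hM h).1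
        rw [norm_zero] at this
        linarith
      have : (fun x : E4 => φ ‖x‖) =ᶠ[𝓝 0] fun _ => 0 := notMem_tsupport_iff_eventuallyEq.1 h0
      have hz := (hasFDerivAt_const (𝕜 := ℝ) (0 : ℝ) (0 : E4)).congr_of_eventuallyEq this
      simpa using hz
    · have hn : HasFDerivAt (fun x : E4 => ‖x‖) (‖x‖⁻¹ • innerSL ℝ x) x := by
        have := (hasStrictFDerivAt_norm_sq x).hasFDerivAt.sqrt (by simpa using hx)
        simp only [Real.sqrt_sq (norm_nonneg _)] at this
        refine this.congr_fderiv ?_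
        ext v
        simp
        ring
      have := ((h1.differentiable (by simp)).differentiableAt (x := ‖x‖)).hasDerivAt.comp_hasFDerivAt
        x hn
      rw [smul_smul, ← div_eq_mul_inv] at this
      exact this
  refine ⟨?_, hM, fun x => (hd x).differentiableAt, fun x v => ?_⟩
  · refine (isCompact_Mbar).of_isClosed_subset (isClosed_tsupport _) (hM.trans M_subset_Mbar)
  · rw [(hd x).fderiv]
    simp
    ring

/-- Integration by parts in each coordinate against the radial test function φ(‖x‖), whose gradient
is φ'(‖x‖) x/‖x‖. Only the flux of X through spheres survives on the right. -/
theorem integral_radial_divergence {X : Fin 4 → E4 → ℂ} (hX : ∀ j, ContDiffOn ℝ ∞ (X j) M)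
    {φ : ℝ → ℝ} (h1 : ContDiff ℝ ∞ φ) (h3 : tsupport φ ⊆ Ioo 1 2) :
    Integrable (fun x => φ ‖x‖ • ∑ j, fderiv ℝ (X j) x (stdB j)) ∧
    Integrable (fun x : E4 => deriv φ ‖x‖ • ∑ j, ((x j / ‖x‖ : ℝ) : ℂ) * X j x) ∧
    ∫ x, φ ‖x‖ • ∑ j, fderiv ℝ (X j) x (stdB j) =
      -∫ x : E4, deriv φ ‖x‖ • ∑ j, ((x j / ‖x‖ : ℝ) : ℂ) * X j x := by
  obtain ⟨hc, hM, hdiff, hder⟩ := radial_facts h1 h3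
  have hφ' : ContDiff ℝ ∞ (deriv φ) := (contDiff_infty_iff_deriv.1 h1).2
  have hs' : tsupport (deriv φ) ⊆ Ioo 1 2 :=
    (closure_minimal (support_deriv_subset) (isClosed_tsupport φ)).trans h3
  obtain ⟨hc', hM', -, -⟩ := radial_facts hφ' hs'
  have hcont : Continuous (fun x : E4 => φ ‖x‖) := h1.continuous.comp continuous_norm
  have hcont' : Continuous (fun x : E4 => deriv φ ‖x‖) := hφ'.continuous.comp continuous_norm
  have hXd (j) : ContinuousOn (fun x => fderiv ℝ (X j) x (stdB j)) M :=
    ((hX j).continuousOn_fderiv_of_isOpen isOpen_M (by simp)).clm_apply continuousOn_const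
  have hXc (j) : ContinuousOn (fun x : E4 => ((x j / ‖x‖ : ℝ) : ℂ) * X j x) M := by
    refine ContinuousOn.mul (Complex.continuous_ofReal.comp_continuousOn ?_) (hX j).continuousOn
    refine ContinuousOn.div (by fun_prop) (by fun_prop) fun x hx => ?_
    exact (one_pos.trans hx.1).ne'
  have i1 (j) := integrable_smul_of_tsupport_subset (μ := volume) isOpen_M hcont hc hM (hXd j)
  have i2 (j) := integrable_smul_of_tsupport_subset (μ := volume) isOpen_M hcont' hc' hM' (hXc j)
  have i3 (j) := integrable_smul_of_tsupport_subset (μ := volume) isOpen_M hcont hc hM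
    (hX j).continuousOn
  have e2 (j) : (fun x => fderiv ℝ (fun x : E4 => φ ‖x‖) x (stdB j) • X j x) =
      fun x : E4 => deriv φ ‖x‖ • (((x j / ‖x‖ : ℝ) : ℂ) * X j x) := by
    ext1 x
    have : inner ℝ x (stdB j) = x j := by simp [stdB, EuclideanSpace.inner_single_right]
    rw [hder, this, mul_smul, Complex.real_smul (x := x j / ‖x‖)]
  have parts (j) := integral_smul_fderiv_eq_neg_fderiv_smul_of_integrable (μ := volume) (𝕜 := ℝ)
    (f := fun x : E4 => φ ‖x‖) (g := X j) (v := stdB j) (by rw [e2]; exact i2 j) (i1 j) (i3 j)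
    (fun x _ => hdiff x) (fun x hx =>
      ((hX j).contDiffAt (isOpen_M.mem_nhds (hM hx))).differentiableAt (by simp))
  simp only [Finset.smul_sum]
  refine ⟨integrable_finsetSum _ fun j _ => i1 j, integrable_finsetSum _ fun j _ => i2 j, ?_⟩
  rw [integral_finsetSum _ fun j _ => i1 j, integral_finsetSum _ fun j _ => i2 j,
    ← Finset.sum_neg_distrib]
  refine Finset.sum_congr rfl fun j _ => ?_
  rw [parts j, e2]

theorem integral_radial_eq {φ : ℝ → ℝ} (h3 : tsupport φ ⊆ Ioo 1 2) {F : E4 → ℂ}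
    (hF : Integrable (fun x => φ ‖x‖ • F x)) :
    ∫ x, φ ‖x‖ • F x = ∫ r, φ r • sphereIntegral F r := by
  rw [(integral_polar hF).2]
  rw [setIntegral_congr_fun measurableSet_Ioi fun r hr => sphereIntegral_radial_smul hr]
  refine setIntegral_eq_integral_of_forall_compl_eq_zero fun r hr => ?_
  have h0 : φ r = 0 :=
    image_eq_zero_of_notMem_tsupport fun h => hr (one_pos.trans (h3 h).1)
  rw [h0, zero_smul]

/-- In polar coordinates the radial integration by parts says that the spherical integral of div X
is the weak radial derivative of the flux. Both are continuous in r, so the fundamental theorem of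
calculus applies. -/
theorem sphereIntegral_divergence {X : Fin 4 → E4 → ℂ} (hX : ∀ j, ContDiffOn ℝ ∞ (X j) M)
    {a b : ℝ} (ha : a ∈ Ioo (1 : ℝ) 2) (hb : b ∈ Ioo (1 : ℝ) 2) :
    sphereIntegral (fun x => ∑ j, ((x j / ‖x‖ : ℝ) : ℂ) * X j x) b -
      sphereIntegral (fun x => ∑ j, ((x j / ‖x‖ : ℝ) : ℂ) * X j x) a =
    ∫ r in a..b, sphereIntegral (fun x => ∑ j, fderiv ℝ (X j) x (stdB j)) r := by
  refine sub_eq_integral_of_weak_deriv (a := 1) (b := 2) ?_ ?_ ?_ ha hb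
  · refine continuousOn_sphereIntegral (continuousOn_finsetSum _ fun j _ => ?_)
    refine ContinuousOn.mul (Complex.continuous_ofReal.comp_continuousOn ?_) (hX j).continuousOn
    refine ContinuousOn.div (by fun_prop) (by fun_prop) fun x hx => ?_
    exact (one_pos.trans hx.1).ne'
  · exact continuousOn_sphereIntegral (continuousOn_finsetSum _ fun j _ =>
      ((hX j).continuousOn_fderiv_of_isOpen isOpen_M (by simp)).clm_apply continuousOn_const)
  · intro φ h1 _ h3
    obtain ⟨i1, i2, h⟩ := integral_radial_divergence hX h1 h3
    have hs' : tsupport (deriv φ) ⊆ Ioo 1 2 :=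
      (closure_minimal (support_deriv_subset) (isClosed_tsupport φ)).trans h3
    rwa [integral_radial_eq h3 i1, integral_radial_eq hs' i2] at h

/-! ### Stokes' theorem on the shell -/

/-- The components of the vector field dual to a `3`-form. -/
def dualField (β : Form 3) (j : Fin 4) (x : E4) : ℂ :=
  (-1) ^ (j : ℕ) * β x (fun k => stdB (j.succAbove k))

theorem contDiffOn_dualField {k : WithTop ℕ∞} {s : Set E4} {β : Form 3} (hβ : ContDiffOn ℝ k β s)
    (j : Fin 4) : ContDiffOn ℝ k (dualField β j) s :=
  contDiffOn_const.mul ((ContinuousAlternatingMap.apply ℝ E4 ℂ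
    (fun k => stdB (j.succAbove k))).contDiff.comp_contDiffOn hβ)

theorem sliceIntegral_eq_sphereIntegral {r : ℝ} (hr : 0 < r) (β : Form 3) :
    sliceIntegral r β = sphereIntegral (fun x => ∑ j, ((x j / ‖x‖ : ℝ) : ℂ) * dualField β j x) r := by
  simp only [sliceIntegral, sphereIntegral, norm_smul_sphere hr, dualField]
  congr 1
  ext1 u
  congr 1
  refine Finset.sum_congr rfl fun j _ => ?_
  have : (r • (u : E4)) j / r = (u : E4) j := by
    simp [hr.ne']
  rw [this]
  ring

theorem topCoeff_extDeriv {β : Form 3} {x : E4} (hβ : DifferentiableAt ℝ β x) :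
    topCoeff (extDeriv β x) = ∑ j, fderiv ℝ (dualField β j) x (stdB j) := by
  rw [topCoeff, extDeriv_apply hβ]
  refine Finset.sum_congr rfl fun j _ => ?_
  have hd : DifferentiableAt ℝ (fun y => β y (j.removeNth stdB)) x :=
    (ContinuousAlternatingMap.apply ℝ E4 ℂ (j.removeNth stdB)).differentiableAt.comp x hβ
  have : dualField β j = fun y => ((-1) ^ (j : ℕ) : ℂ) * β y (j.removeNth stdB) := rfl
  rw [this, fderiv_const_mul hd]
  simp

/-- Stokes' theorem between two slices: contraction with the volume form turns β into a vector
field, dβ into its divergence and the slice integral into its flux. -/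
theorem sliceIntegral_sub_eq {β : Form 3} (hβ : ContDiffOn ℝ ∞ β M) {a b : ℝ}
    (ha : a ∈ Ioo (1 : ℝ) 2) (hb : b ∈ Ioo (1 : ℝ) 2) :
    sliceIntegral b β - sliceIntegral a β =
      ∫ r in a..b, sphereIntegral (fun x => topCoeff (extDeriv β x)) r := by
  rw [sliceIntegral_eq_sphereIntegral (one_pos.trans ha.1),
    sliceIntegral_eq_sphereIntegral (one_pos.trans hb.1),
    sphereIntegral_divergence (contDiffOn_dualField hβ) ha hb]
  refine intervalIntegral.integral_congr fun r hr => ?_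
  have hr' : r ∈ Ioo (1 : ℝ) 2 := (convex_Ioo 1 2).ordConnected.uIcc_subset ha hb hr
  simp only [sphereIntegral]
  congr 1
  ext1 u
  rw [topCoeff_extDeriv (differentiableAt_of_contDiffOn_M hβ (smul_sphere_mem_M hr' u))]

theorem sliceIntegral_congr {β β' : Form 3} {r : ℝ} (hr : 0 < r)
    (h : ∀ x, ‖x‖ = r → β x = β' x) : sliceIntegral r β = sliceIntegral r β' := by
  simp only [sliceIntegral]
  congr 1
  ext1 u
  rw [h _ (norm_smul_sphere hr u)]

/-- The integral of an exact form over a slice vanishes. -/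
theorem sliceIntegral_extDeriv_eq_zero {α : Form 2} (hα : ContDiffOn ℝ ∞ α M) {r : ℝ}
    (hr : r ∈ Ioo (1 : ℝ) 2) : sliceIntegral r (extDeriv α) = 0 := by
  obtain ⟨hr1, hr2⟩ := hr
  -- Radii 1 < a < l < m < r. The cutoff χ vanishes up to radius l and equals 1 from m on, so d(χα)
  -- is zero on the slice a and dα on the slice r; Stokes with d² = 0 identifies the two integrals.
  set m := (1 + r) / 2 with hm
  set l := (1 + m) / 2 with hl
  set a := (1 + l) / 2 with ha
  have h1a : 1 < a := by linarith
  have hal : a < l := by linarith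
  have hlm : l < m := by linarith
  have hmr : m < r := by linarith
  have hpos : 0 < m ^ 2 - l ^ 2 := by nlinarith
  let χ : E4 → ℝ := fun x => Real.smoothTransition ((‖x‖ ^ 2 - l ^ 2) / (m ^ 2 - l ^ 2))
  have hχ : ContDiff ℝ ∞ χ :=
    Real.smoothTransition.contDiff.comp (((contDiff_norm_sq ℝ).sub contDiff_const).div_const _)
  have hχα : ContDiffOn ℝ ∞ (fun x => χ x • α x) M := hχ.contDiffOn.smul hα
  have hβ := contDiffOn_extDeriv isOpen_M hχα
  have haM : a ∈ Ioo (1 : ℝ) 2 := ⟨h1a, by linarith⟩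
  have hst := sliceIntegral_sub_eq hβ haM ⟨hr1, hr2⟩
  have hzero : ∫ s in a..r, sphereIntegral
      (fun x => topCoeff (extDeriv (extDeriv fun x => χ x • α x) x)) s = 0 := by
    refine intervalIntegral.integral_zero_ae (.of_forall fun s hs => ?_)
    have hs' : s ∈ Ioo (1 : ℝ) 2 :=
      (convex_Ioo 1 2).ordConnected.uIcc_subset haM ⟨hr1, hr2⟩ (uIoc_subset_uIcc hs)
    have (u : Metric.sphere (0 : E4) 1) :
        extDeriv (extDeriv fun x => χ x • α x) (s • (u : E4)) = 0 :=
      extDeriv_extDeriv_apply (hχα.contDiffAt (isOpen_M.mem_nhds (smul_sphere_mem_M hs' u)))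
        two_le_smoothness
    simp [sphereIntegral, this, topCoeff]
  have hone : sliceIntegral r (extDeriv fun x => χ x • α x) = sliceIntegral r (extDeriv α) := by
    refine sliceIntegral_congr (one_pos.trans hr1) fun x hx => Filter.EventuallyEq.extDeriv_eq ?_
    have : ∀ᶠ y in 𝓝 x, m < ‖y‖ := continuous_norm.continuousAt.eventually_const_lt
      (hmr.trans_eq hx.symm)
    filter_upwards [this] with y hy
    have : χ y = 1 := by
      refine Real.smoothTransition.one_of_one_le ?_
      rw [one_le_div hpos]
      nlinarith
    rw [this, one_smul]
  have hnil : sliceIntegral a (extDeriv fun x => χ x • α x) = 0 := by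
    have : sliceIntegral a (extDeriv fun x => χ x • α x) = sliceIntegral a (0 : Form 3) := by
      refine sliceIntegral_congr (one_pos.trans h1a) fun x hx => ?_
      have hev : (fun x => χ x • α x) =ᶠ[𝓝 x] fun _ => (0 : Cov 2) := by
        have : ∀ᶠ y in 𝓝 x, ‖y‖ < l := continuous_norm.continuousAt.eventually_lt_const
          (hx.trans_lt hal)
        filter_upwards [this] with y hy
        have : χ y = 0 := by
          refine Real.smoothTransition.zero_of_nonpos (div_nonpos_of_nonpos_of_nonneg ?_ hpos.le)
          nlinarith [norm_nonneg y]
        rw [this]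
        exact zero_smul ℝ (α y)
      rw [hev.extDeriv_eq]
      ext v
      simp [extDeriv, ContinuousAlternatingMap.alternatizeUncurryFin_apply]
    rw [this]
    simp [sliceIntegral]
  rw [hzero, hone, hnil, sub_zero] at hst
  exact hst

theorem integrable_slice {β : Form 3} (hβ : ContinuousOn β M) {r : ℝ} (hr : r ∈ Ioo (1 : ℝ) 2) :
    Integrable (fun u : Metric.sphere (0 : E4) 1 =>
      ((r ^ 3 : ℝ) : ℂ) * ∑ j : Fin 4, (-1) ^ (j : ℕ) * (((u : E4) j : ℝ) : ℂ) *
        β (r • (u : E4)) (fun k => stdB (j.succAbove k))) (volume : Measure E4).toSphere := by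
  have hc : Continuous fun u : Metric.sphere (0 : E4) 1 => β (r • (u : E4)) :=
    hβ.comp_continuous (by fun_prop) fun u => smul_sphere_mem_M hr u
  have hcj (j : Fin 4) : Continuous fun u : Metric.sphere (0 : E4) 1 =>
      β (r • (u : E4)) (fun k => stdB (j.succAbove k)) :=
    (ContinuousAlternatingMap.apply ℝ E4 ℂ (fun k => stdB (j.succAbove k))).continuous.comp hc
  have : Continuous (fun u : Metric.sphere (0 : E4) 1 =>
      ((r ^ 3 : ℝ) : ℂ) * ∑ j : Fin 4, (-1) ^ (j : ℕ) * (((u : E4) j : ℝ) : ℂ) *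
        β (r • (u : E4)) (fun k => stdB (j.succAbove k))) :=
    continuous_const.mul (continuous_finsetSum _ fun j _ =>
      (continuous_const.mul (by fun_prop)).mul (hcj j))
  exact this.integrable_of_hasCompactSupport (HasCompactSupport.of_compactSpace _)

theorem sliceIntegral_sub {β β' : Form 3} (hβ : ContinuousOn β M) (hβ' : ContinuousOn β' M) {r : ℝ}
    (hr : r ∈ Ioo (1 : ℝ) 2) :
    sliceIntegral r (fun x => β x - β' x) = sliceIntegral r β - sliceIntegral r β' := by
  simp only [sliceIntegral]
  rw [← integral_sub (integrable_slice hβ hr) (integrable_slice hβ' hr)]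
  congr 1
  ext1 u
  rw [← mul_sub, ← Finset.sum_sub_distrib]
  simp only [ContinuousAlternatingMap.sub_apply, mul_sub]

theorem sliceIntegral_smul (c : ℂ) (β : Form 3) (r : ℝ) :
    sliceIntegral r (fun x => c • β x) = c * sliceIntegral r β := by
  simp only [sliceIntegral]
  rw [← integral_const_mul]
  congr 1
  ext1 u
  simp only [ContinuousAlternatingMap.smul_apply, smul_eq_mul, Finset.mul_sum]
  refine Finset.sum_congr rfl fun j _ => ?_
  ring

/-! ### Behaviour at the conformal boundary -/

section
variable {Λ : ℝ} {S : SForm 2} {Γ : SForm 1} {Ω : E4 → ℝ} {h h' : Perturbation}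

/-- The conformal weights cancel: ψ Σ₀ = (Ω⁻²ψ)(Ω²Σ₀), a product of fields continuous on the compact
shell. -/
theorem exists_norm_weylForm_le (hΩ : IsConformalCompactification Ω S)
    (hh : IsScatteringState Λ S Γ Ω h) :
    ∃ C, 0 ≤ C ∧ ∀ A B, ∀ x ∈ M, ‖weylForm h.ψ S A B x‖ ≤ C := by
  obtain ⟨S', hS', hSS', -⟩ := hΩ.rescaled
  obtain ⟨φ, hφ, hφψ⟩ := hh.regular_ψ
  refine exists_uniform_bound fun A B => ?_
  have hφI (I) : ContDiffOn ℝ ∞ (fun x => φ x I) Mbar := contDiffOn_pi.1 hφ I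
  have hc : ContDiffOn ℝ ∞ (weylForm φ S' A B) Mbar :=
    ContDiffOn.sum fun C _ => ContDiffOn.sum fun D _ => (hφI _).smul (hS' C D)
  obtain ⟨C, hC⟩ := isCompact_Mbar.exists_bound_of_continuousOn hc.continuousOn
  refine ⟨C, fun x hx => ?_⟩
  have hne : (Ω x : ℂ) ≠ 0 := by exact_mod_cast hΩ.ne_zero x hx
  have : weylForm h.ψ S A B x = weylForm φ S' A B x := by
    ext v
    simp only [weylForm_eq, hφψ hx, hSS' _ _ x hx, ContinuousAlternatingMap.add_apply,
      ContinuousAlternatingMap.smul_apply, Pi.smul_apply, Complex.real_smul, smul_eq_mul]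
    push_cast
    field_simp
  rw [this]
  exact hC x (M_subset_Mbar hx)

theorem norm_sliceIntegral_le {β : Form 3} {r K : ℝ} (hr : r ∈ Ioo (1 : ℝ) 2)
    (hβ : ∀ x, ‖x‖ = r → ‖β x‖ ≤ K) :
    ‖sliceIntegral r β‖ ≤ 32 * K * (volume : Measure E4).toSphere.real univ := by
  refine norm_integral_le_of_norm_le_const (.of_forall fun u => ?_)
  have hr0 : 0 < r := one_pos.trans hr.1
  have hj (j : Fin 4) : ‖(-1) ^ (j : ℕ) * (((u : E4) j : ℝ) : ℂ) *
      β (r • (u : E4)) (fun k => stdB (j.succAbove k))‖ ≤ K := by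
    have h1 : ‖β (r • (u : E4)) (fun k => stdB (j.succAbove k))‖ ≤ K := by
      refine ((β (r • (u : E4))).le_opNorm _).trans ?_
      simpa [stdB] using hβ _ (norm_smul_sphere hr0 u)
    have h2 : ‖(u : E4) j‖ ≤ 1 := (PiLp.norm_apply_le (u : E4) j).trans (by simp)
    rw [norm_mul, norm_mul, norm_pow, norm_neg, norm_one, one_pow, one_mul, Complex.norm_real]
    exact (mul_le_mul h2 h1 (norm_nonneg _) zero_le_one).trans (one_mul K).le
  have hr3 : r ^ 3 ≤ 8 := by
    calc r ^ 3 ≤ 2 ^ 3 := pow_le_pow_left₀ hr0.le hr.2.le 3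
      _ = 8 := by norm_num
  rw [norm_mul, Complex.norm_real, Real.norm_of_nonneg (pow_pos hr0 3).le]
  have hs : ‖∑ j : Fin 4, (-1) ^ (j : ℕ) * (((u : E4) j : ℝ) : ℂ) *
      β (r • (u : E4)) (fun k => stdB (j.succAbove k))‖ ≤ 4 * K :=
    (norm_sum_le_of_le _ fun j _ => hj j).trans (by simp)
  -- The bound r³ ≤ 8 and the four components of the unit normal give the constant 32.
  calc _ ≤ 8 * (4 * K) := mul_le_mul hr3 hs (norm_nonneg _) (by norm_num)
    _ = 32 * K := by ring

/-- Compare Ω at x with its value 0 at the radial projection of x to the boundary sphere; uniform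
continuity on the compact shell makes δ independent of direction. -/
theorem exists_abs_conformalFactor_le (hΩ : IsConformalCompactification Ω S) {ρ : ℝ}
    (hρ : ρ = 1 ∨ ρ = 2) {η : ℝ} (hη : 0 < η) :
    ∃ δ > 0, ∀ x ∈ M, |‖x‖ - ρ| < δ → |Ω x| < η := by
  obtain ⟨δ, hδ, h⟩ := Metric.uniformContinuousOn_iff.1
    (isCompact_Mbar.uniformContinuousOn_of_continuous hΩ.smooth.continuousOn) η hη
  refine ⟨δ, hδ, fun x hx hd => ?_⟩
  have hx0 : 0 < ‖x‖ := one_pos.trans hx.1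
  have hρ0 : 0 < ρ := by rcases hρ with rfl | rfl <;> norm_num
  have hy : ‖(ρ / ‖x‖) • x‖ = ρ := by
    rw [norm_smul, Real.norm_of_nonneg (div_pos hρ0 hx0).le, div_mul_cancel₀ _ hx0.ne']
  have hyM : (ρ / ‖x‖) • x ∈ Mbar := by
    change 1 ≤ ‖_‖ ∧ ‖_‖ ≤ 2
    rw [hy]
    rcases hρ with rfl | rfl <;> norm_num
  have hyΩ : Ω ((ρ / ‖x‖) • x) = 0 := by
    refine hΩ.eq_zero _ ?_
    rcases hρ with rfl | rfl
    · exact Or.inl (by simpa [scri] using hy)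
    · exact Or.inr (by simpa [scri] using hy)
  have hdist : dist x ((ρ / ‖x‖) • x) = |‖x‖ - ρ| := by
    have : x - (ρ / ‖x‖) • x = (1 - ρ / ‖x‖) • x := by rw [sub_smul, one_smul]
    rw [dist_eq_norm, this, norm_smul, Real.norm_eq_abs]
    conv_lhs => rw [← abs_of_pos hx0]
    rw [← abs_mul, abs_of_pos hx0, sub_mul, div_mul_cancel₀ _ hx0.ne', one_mul]
  have := h x (M_subset_Mbar hx) _ hyM (hdist.trans_lt hd)
  rwa [hyΩ, Real.dist_eq, sub_zero] at this

/-- The current of a state whose `σ` is regular at `scri ρ` has no flux through `scri ρ`. -/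
theorem tendsto_sliceIntegral_current (hbg : IsSelfDualBackground Λ S Γ)
    (hΩ : IsConformalCompactification Ω S) (hh : IsScatteringState Λ S Γ Ω h)
    (hh' : IsScatteringState Λ S Γ Ω h') {ρ : ℝ}
    (hρ : ρ = 1 ∨ ρ = 2) (hσ : ∀ A B, ExtendsSmoothly (h.σ A B) M (M ∪ scri ρ)) :
    Tendsto (fun r => sliceIntegral r (contract (n := 3) rfl h.γ (lower (weylForm h'.ψ S))))
      (𝓝[Ioo 1 2] ρ) (𝓝 0) := by
  obtain ⟨C, hC, hγ⟩ := exists_norm_gamma_le hbg hΩ hh hρ hσ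
  obtain ⟨K, hK, hΨ⟩ := exists_norm_weylForm_le hΩ hh'
  obtain ⟨W, hW, hw⟩ := exists_norm_wedgeCov_le (p := 1) (q := 2) (n := 3) rfl
  set V := (volume : Measure E4).toSphere.real univ
  have hV : 0 ≤ V := measureReal_nonneg
  set L := 32 * (4 * (W * C * K)) * V with hL
  have hL0 : 0 ≤ L := by positivity
  rw [Metric.tendsto_nhdsWithin_nhds]
  intro η hη
  -- L collects all constants of the flux estimate; dividing by L + 1 rather than L covers L = 0 and
  -- makes the final bound strict.
  obtain ⟨δ, hδ, hΩδ⟩ := exists_abs_conformalFactor_le hΩ hρ (show 0 < η / (L + 1) by positivity)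
  refine ⟨min δ (1 / 2), by positivity, fun r hr hd => ?_⟩
  rw [Real.dist_eq, lt_min_iff] at hd
  have hη' : 0 < η / (L + 1) := by positivity
  have hb : ‖sliceIntegral r (contract (n := 3) rfl h.γ (lower (weylForm h'.ψ S)))‖ ≤
      32 * (4 * (W * (C * (η / (L + 1))) * K)) * V := by
    refine norm_sliceIntegral_le hr fun x hx => ?_
    subst hx
    have hxM : x ∈ M := hr
    have h1 (A B) : ‖h.γ A B x‖ ≤ C * (η / (L + 1)) :=
      (hγ x hxM hd.2.le A B).trans (mul_le_mul_of_nonneg_left (hΩδ x hxM hd.1).le hC)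
    have h2 (A B) : ‖lower (weylForm h'.ψ S) A B x‖ ≤ K := by
      fin_cases A <;> fin_cases B <;>
        simp [lower_zero_zero, lower_zero_one, lower_one_zero, lower_one_one, hΨ _ _ x hxM]
    have h3 (A B) : ‖wedge (n := 3) rfl (h.γ A B) (lower (weylForm h'.ψ S) A B) x‖ ≤
        W * (C * (η / (L + 1))) * K :=
      (hw _ _).trans (mul_le_mul (mul_le_mul_of_nonneg_left (h1 A B) hW) (h2 A B) (norm_nonneg _)
        (by positivity))
    rw [contract_eq]
    refine (norm_add_le _ _).trans ((add_le_add (norm_add_le _ _) (norm_add_le _ _)).trans ?_)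
    linarith [h3 0 0, h3 0 1, h3 1 0, h3 1 1]
  rw [dist_zero_right]
  refine hb.trans_lt ?_
  calc 32 * (4 * (W * (C * (η / (L + 1))) * K)) * V = L / (L + 1) * η := by rw [hL]; ring
    _ < 1 * η := mul_lt_mul_of_pos_right (by rw [div_lt_one (by positivity)]; linarith) hη
    _ = η := one_mul η

/-! ### The conformal gravity integrand -/

theorem cgDensity_comm (hh : IsScatteringState Λ S Γ Ω h) (hh' : IsScatteringState Λ S Γ Ω h')
    (x : E4) : cgDensity S h h' x = cgDensity S h' h x := by
  rw [cgDensity, cgDensity, contract4_eq (hh.symm_ψ x) (hh'.symm_ψ x),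
    contract4_eq (hh'.symm_ψ x) (hh.symm_ψ x)]
  ring

/-- The two factors Ω⁻² of the Weyl spinors and the factor Ω⁴ of the rescaled volume form cancel, so
the density agrees on M with a function continuous on the compact shell. -/
theorem integrableOn_cgDensity (hΩ : IsConformalCompactification Ω S)
    (hh : IsScatteringState Λ S Γ Ω h) (hh' : IsScatteringState Λ S Γ Ω h') :
    IntegrableOn (cgDensity S h h') M := by
  obtain ⟨S', hS', hSS', -⟩ := hΩ.rescaled
  obtain ⟨φ, hφ, hφψ⟩ := hh.regular_ψ
  obtain ⟨χ, hχ, hχψ⟩ := hh'.regular_ψ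
  have hφI (I) : ContinuousOn (fun x => φ x I) Mbar := (contDiffOn_pi.1 hφ I).continuousOn
  have hχI (I) : ContinuousOn (fun x => χ x I) Mbar := (contDiffOn_pi.1 hχ I).continuousOn
  have hlow (A B) : ContDiffOn ℝ ∞ (lower S' A B) Mbar := contDiffOn_lower hS' A B
  have hvol : ContinuousOn (fun x => topCoeff (volForm S' x)) Mbar := by
    have h1 : ContDiffOn ℝ ∞ (contract (n := 4) rfl S' (lower S')) Mbar :=
      contDiffOn_contract rfl hS' hlow
    have h2 : ContinuousOn (fun x => topCoeff (contract (n := 4) rfl S' (lower S') x)) Mbar :=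
      (ContinuousAlternatingMap.apply ℝ E4 ℂ stdB).continuous.comp_continuousOn h1.continuousOn
    simp only [volForm, topCoeff_smul]
    exact continuousOn_const.mul h2
  have hcont : ContinuousOn (fun x => contract4 (φ x) (χ x) * topCoeff (volForm S' x)) Mbar :=
    ContinuousOn.mul (continuousOn_finsetSum _ fun I _ => continuousOn_finsetSum _ fun J _ =>
      (continuousOn_const.mul (hφI J)).mul (hχI I)) hvol
  refine ((hcont.integrableOn_compact isCompact_Mbar).mono_set M_subset_Mbar).congr_fun
    (fun x hx => ?_) isOpen_M.measurableSet
  have hne : (Ω x : ℂ) ≠ 0 := by exact_mod_cast hΩ.ne_zero x hx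
  have e1 : contract4 (φ x) (χ x) = ((Ω x : ℂ) ^ 4)⁻¹ * contract4 (h.ψ x) (h'.ψ x) := by
    simp only [contract4, hφψ hx, hχψ hx, Pi.smul_apply, Complex.real_smul, Finset.mul_sum]
    refine Finset.sum_congr rfl fun I _ => Finset.sum_congr rfl fun J _ => ?_
    push_cast
    field_simp
  have e2 : topCoeff (volForm S' x) = (Ω x : ℂ) ^ 4 * topCoeff (volForm S x) := by
    have hS (A B) : S' A B x = ((Ω x : ℂ) ^ 2) • S A B x := by
      rw [hSS' A B x hx]
      ext v
      simp [Complex.real_smul]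
    simp only [volForm, contract_eq, wedge, lower_zero_zero, lower_zero_one, lower_one_zero,
      lower_one_one, Pi.neg_apply, wedgeCov_neg_right, hS, wedgeCov_smul_left, wedgeCov_smul_right,
      topCoeff, ContinuousAlternatingMap.smul_apply, ContinuousAlternatingMap.add_apply,
      ContinuousAlternatingMap.neg_apply, smul_eq_mul]
    ring
  simp only [e1, e2, cgDensity]
  field_simp

end

/-! ### Radial integration -/

theorem integral_M_eq {f : E4 → ℂ} (hf : IntegrableOn f M) :
    IntervalIntegrable (sphereIntegral f) volume 1 2 ∧
      ∫ x in M, f x = ∫ r in (1 : ℝ)..2, sphereIntegral f r := by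
  have hM := isOpen_M.measurableSet
  obtain ⟨h1, h2⟩ := integral_polar ((integrable_indicator_iff hM).2 hf)
  have hsub : Ioo (1 : ℝ) 2 ⊆ Ioi 0 := fun r hr => one_pos.trans hr.1
  have hind : EqOn (sphereIntegral (M.indicator f)) ((Ioo 1 2).indicator (sphereIntegral f))
      (Ioi 0) := by
    intro r hr
    by_cases hr' : r ∈ Ioo (1 : ℝ) 2
    · simp [sphereIntegral, hr', indicator_of_mem (smul_sphere_mem_M hr' _)]
    · have (u : Metric.sphere (0 : E4) 1) : r • (u : E4) ∉ M := fun hu => hr' (by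
        simpa only [M, mem_ofPred_eq, mem_Ioo, norm_smul_sphere hr u] using hu)
      simp [sphereIntegral, hr', indicator_of_notMem (this _)]
  constructor
  · rw [intervalIntegrable_iff_integrableOn_Ioo_of_le one_le_two]
    have := (h1.congr_fun hind measurableSet_Ioi).mono_set hsub
    exact this.congr_fun (fun r hr => indicator_of_mem hr _) measurableSet_Ioo
  · rw [← integral_indicator hM, h2, setIntegral_congr_fun measurableSet_Ioi hind,
      setIntegral_indicator measurableSet_Ioo, inter_eq_self_of_subset_right hsub,
      intervalIntegral.integral_of_le one_le_two, integral_Ioc_eq_integral_Ioo]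

/-- Let s tend to ρ in F r = F s + ∫_s^r g. Integrability up to the endpoints makes the primitive
continuous there, and the limit within the open interval is unique because ρ lies in its closure. -/
theorem eq_integral_of_tendsto_zero {F g : ℝ → ℂ} {a b ρ r : ℝ} (hab : a < b)
    (hg : IntervalIntegrable g volume a b)
    (hF : ∀ s ∈ Ioo a b, ∀ t ∈ Ioo a b, F t - F s = ∫ x in s..t, g x) (hρ : ρ ∈ Icc a b)
    (hlim : Tendsto F (𝓝[Ioo a b] ρ) (𝓝 0)) (hr : r ∈ Ioo a b) : F r = ∫ x in ρ..r, g x := by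
  have : (𝓝[Ioo a b] ρ).NeBot := by
    rw [← mem_closure_iff_nhdsWithin_neBot, closure_Ioo hab.ne]
    exact hρ
  have hprim : Tendsto (fun s => ∫ x in r..s, g x) (𝓝[Ioo a b] ρ) (𝓝 (∫ x in r..ρ, g x)) := by
    have hc := intervalIntegral.continuousOn_primitive_interval' hg
      (a := r) (uIcc_of_le hab.le ▸ Ioo_subset_Icc_self hr)
    rw [uIcc_of_le hab.le] at hc
    exact (hc ρ hρ).tendsto.mono_left (nhdsWithin_mono _ Ioo_subset_Icc_self)
  have h0 : Tendsto (fun s => F r + ∫ x in r..s, g x) (𝓝[Ioo a b] ρ) (𝓝 0) := by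
    refine hlim.congr' ?_
    filter_upwards [self_mem_nhdsWithin] with s hs
    rw [← hF r hr s hs, add_sub_cancel]
  have := tendsto_nhds_unique h0 (hprim.const_add (F r))
  rw [intervalIntegral.integral_symm, eq_neg_iff_add_eq_zero]
  exact this.symm

section
variable {Λ : ℝ} {S : SForm 2} {Γ : SForm 1} {Ω : E4 → ℝ} {h h' : Perturbation}

theorem contDiffOn_current (hbg : IsSelfDualBackground Λ S Γ)
    (hh : IsScatteringState Λ S Γ Ω h) (hh' : IsScatteringState Λ S Γ Ω h') :
    ContDiffOn ℝ ∞ (contract (n := 3) rfl h.γ (lower (weylForm h'.ψ S))) M :=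
  contDiffOn_contract rfl hh.smooth_γ
    (contDiffOn_lower (contDiffOn_weylForm hbg hh'))

/-- Combines dJ = 2ψψ' dμ with the vanishing flux at ρ. The oriented integral handles both ends: for
ρ = 2 it is minus the integral over the part after the slice. -/
theorem sliceIntegral_current (hbg : IsSelfDualBackground Λ S Γ)
    (hΩ : IsConformalCompactification Ω S) (hh : IsScatteringState Λ S Γ Ω h)
    (hh' : IsScatteringState Λ S Γ Ω h') {ρ : ℝ}
    (hρ : ρ = 1 ∨ ρ = 2) (hσ : ∀ A B, ExtendsSmoothly (h.σ A B) M (M ∪ scri ρ))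
    {r : ℝ} (hr : r ∈ Ioo (1 : ℝ) 2) :
    sliceIntegral r (contract (n := 3) rfl h.γ (lower (weylForm h'.ψ S))) =
      2 * ∫ s in ρ..r, sphereIntegral (cgDensity S h h') s := by
  have hint := (integral_M_eq (integrableOn_cgDensity hΩ hh hh')).1
  rw [← intervalIntegral.integral_const_mul]
  refine eq_integral_of_tendsto_zero one_lt_two (hint.const_mul 2) (fun s hs t ht => ?_)
    (by rcases hρ with rfl | rfl <;> norm_num)
    (tendsto_sliceIntegral_current hbg hΩ hh hh' hρ hσ) hr
  rw [sliceIntegral_sub_eq (contDiffOn_current hbg hh hh') hs ht]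
  refine intervalIntegral.integral_congr fun q hq => ?_
  have hq' : q ∈ Ioo (1 : ℝ) 2 := (convex_Ioo 1 2).ordConnected.uIcc_subset hs ht hq
  simp only [sphereIntegral]
  rw [← integral_const_mul]
  congr 1
  ext1 u
  rw [topCoeff_extDeriv_current hbg hh hh' (smul_sphere_mem_M hq' u)]
  ring

/-- The symplectic product of a state regular at past infinity with one regular at future infinity
is a multiple of the conformal gravity integral. -/
theorem sliceIntegral_symplectic (hΛ : Λ ≠ 0) (hbg : IsSelfDualBackground Λ S Γ)
    (hΩ : IsConformalCompactification Ω S) (hh : IsScatteringState Λ S Γ Ω h)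
    (hh' : IsScatteringState Λ S Γ Ω h')
    (hσ : ∀ A B, ExtendsSmoothly (h.σ A B) M (M ∪ scri 1))
    (hσ' : ∀ A B, ExtendsSmoothly (h'.σ A B) M (M ∪ scri 2))
    {r : ℝ} (hr : r ∈ Ioo (1 : ℝ) 2) :
    sliceIntegral r (fun x => contract (n := 3) rfl h.σ h'.γ x - contract (n := 3) rfl h'.σ h.γ x) =
      6 / (Λ : ℂ) * ∫ x in M, cgDensity S h h' x := by
  -- Each current is measured from the end where its own γ decays: J(h',h) from future infinity,
  -- J(h,h') from past infinity.
  have hA := sliceIntegral_current hbg hΩ hh' hh (Or.inr rfl) hσ' hr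
  have hB := sliceIntegral_current hbg hΩ hh hh' (Or.inl rfl) hσ hr
  have hcomm : cgDensity S h' h = cgDensity S h h' := funext (cgDensity_comm hh' hh)
  rw [hcomm] at hA
  obtain ⟨hint, hM⟩ := integral_M_eq (integrableOn_cgDensity hΩ hh hh')
  have hri : r ∈ uIcc (1 : ℝ) 2 := by
    rw [uIcc_of_le one_le_two]
    exact Ioo_subset_Icc_self hr
  have hadd := intervalIntegral.integral_add_adjacent_intervals
    (hint.mono_set (uIcc_subset_uIcc left_mem_uIcc hri))
    (hint.mono_set (uIcc_subset_uIcc hri right_mem_uIcc))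
  rw [intervalIntegral.integral_symm] at hA
  have hγγ : ContDiffOn ℝ ∞ (contract (n := 2) rfl h.γ (lower h'.γ)) M :=
    contDiffOn_contract rfl hh.smooth_γ (contDiffOn_lower hh'.smooth_γ)
  have hdγ := (contDiffOn_extDeriv isOpen_M hγγ).continuousOn
  have hσγ : ContDiffOn ℝ ∞ (fun x =>
      contract (n := 3) rfl h.σ h'.γ x - contract (n := 3) rfl h'.σ h.γ x) M :=
    (contDiffOn_contract (n := 3) rfl hh.smooth_σ hh'.smooth_γ).sub
      (contDiffOn_contract (n := 3) rfl hh'.smooth_σ hh.smooth_γ)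
  have hΛσγ : ContDiffOn ℝ ∞ (fun x => ((Λ / 3 : ℝ) : ℂ) •
      (contract (n := 3) rfl h.σ h'.γ x - contract (n := 3) rfl h'.σ h.γ x)) M :=
    ContDiffOn.smul (f := fun _ => ((Λ / 3 : ℝ) : ℂ)) contDiffOn_const hσγ
  have hdiff := sliceIntegral_sub (contDiffOn_current hbg hh' hh).continuousOn
    (contDiffOn_current hbg hh hh').continuousOn hr
  have hcongr := sliceIntegral_congr (one_pos.trans hr.1) fun x (hx : ‖x‖ = r) =>
    current_sub_current hbg hh hh' (x := x) (by subst hx; exact hr)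
  rw [hcongr, sliceIntegral_sub hdγ hΛσγ.continuousOn hr, sliceIntegral_extDeriv_eq_zero hγγ hr,
    sliceIntegral_smul, hA, hB] at hdiff
  have hΛ' : (Λ : ℂ) ≠ 0 := by exact_mod_cast hΛ
  rw [hM, ← hadd]
  push_cast at hdiff
  field_simp
  linear_combination (-3) * hdiff

end

end MHV

end

theorem mainTheorem4 (Λ κ ε : ℝ) (hΛ : Λ ≠ 0) (hκ : κ ≠ 0) (hε : ε ≠ 0)
    (S : MHV.SForm 2) (Γ : MHV.SForm 1) (Ω : MHV.E4 → ℝ)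
    (hbg : MHV.IsSelfDualBackground Λ S Γ)
    (hΩ : MHV.IsConformalCompactification Ω S)
    (h₁ h₂ : MHV.Perturbation)
    (hh₁ : MHV.IsScatteringState Λ S Γ Ω h₁)
    (hh₂ : MHV.IsScatteringState Λ S Γ Ω h₂)
    (hasd₁ : MHV.IsASDAt 1 h₁) (hasd₂ : MHV.IsASDAt 2 h₂) :
    MeasureTheory.IntegrableOn (MHV.cgDensity S h₁ h₂) MHV.M ∧
    ∀ r ∈ Set.Ioo (1 : ℝ) 2,
      MHV.IGR κ r h₁ h₂ =
        -(3 * (ε : ℂ) ^ 2 / ((Λ : ℂ) * (κ : ℂ) ^ 2)) * MHV.ICG ε S h₁ h₂ := by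
  refine ⟨MHV.integrableOn_cgDensity hΩ hh₁ hh₂, fun r hr => ?_⟩
  have hΛ' : (Λ : ℂ) ≠ 0 := by exact_mod_cast hΛ
  have hκ' : (κ : ℂ) ≠ 0 := by exact_mod_cast hκ
  have hε' : (ε : ℂ) ≠ 0 := by exact_mod_cast hε
  -- What remains is to compare prefactors: -(i/κ²)·(6/Λ) equals -(3ε²/(Λκ²))·(2i/ε²).
  rw [MHV.IGR, MHV.innerProduct, MHV.ICG,
    MHV.sliceIntegral_symplectic hΛ hbg hΩ hh₁ hh₂ hasd₁.1 hasd₂.1 hr]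
  field_simp
  ring
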